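/- Let $n\ge 1$, $m\in\mathbf R$ and $0\le\varrho\le 1$. Write $\langle\xi\rangle=(1+|\xi|^2)^{1/2}$ and $\widehat u(\xi)=\int_{\mathbf R^n}e^{-i\langle y,\xi\rangle}u(y)\,dy$. Let $a:\mathbf R^n\times\mathbf R^n\to\mathbf C$ be an amplitude in $L^\infty S^m_\varrho$, i.e. $a(x,\cdot)\in C^\infty(\mathbf R^n)$ for every $x$, $a(\cdot,\xi)$ is measurable for every $\xi$, and for all multi-indices $\alpha$ $$\sup_{\xi\in\mathbf R^n}\langle\xi\rangle^{-m+\varrho|\alpha|}\,\|\partial_\xi^\alpha a(\cdot,\xi)\|_{L^\infty(\mathbf R^n)}<\infty .$$ Let $\varphi(x,\xi)$ be a real-valued phase function in $L^\infty\Phi^2$, i.e. for every $x$ the function $\varphi(x,\cdot)$ is $C^\infty$ on $\mathbf R^n\setminus 0$ and positively homogeneous of degree $1$, $\varphi(\cdot,\xi)$ is measurable for every $\xi\neq 0$, and for all multi-indices $\alpha$ with $|\alpha|\ge 2$ $$\sup_{\xi\in\mathbf R^n\setminus 0}|\xi|^{-1+|\alpha|}\,\|\partial_\xi^\alpha\varphi(\cdot,\xi)\|_{L^\infty(\mathbf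 R^n)}<\infty .$$ Assume that $\varphi$ satisfies the rough non-degeneracy condition: there is a constant $c>0$ such that $$|\partial_\xi\varphi(x,\xi)-\partial_\xi\varphi(y,\xi)|\ge c\,|x-y|\qquad\text{for all }x,y\in\mathbf R^n,\ \xi\in\mathbf R^n\setminus 0 .$$ Suppose that $$m<\frac{n(\varrho-1)}2-\frac{n-1}4 .$$ Then for every Schwartz function $u$ the integral $$Tu(x)=(2\pi)^{-n}\int_{\mathbf R^n}e^{i\varphi(x,\xi)}a(x,\xi)\,\widehat u(\xi)\,d\xi$$ converges absolutely for almost every $x$, $Tu\in L^2(\mathbf R^n)$, and there is a constant $C>0$ independent of $u$ such that $$\|Tu\|_{L^2(\mathbf R^n)}\le C\,\|u\|_{L^2(\mathbf R^n)}\qquad\text{for all }u\in\mathscr S(\mathbf R^n).$$ -/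

import Mathlib

open MeasureTheory
open scoped ENNReal ContDiff

noncomputable section

/-- The partial derivative `∂_{ξ_{i 0}} ⋯ ∂_{ξ_{i (k-1)}} f` of order `k` at `ξ`. As `k` and
`i : Fin k → Fin n` vary, these are the derivatives `∂^α f` over all multi-indices `α`, `|α| = k`. -/
def partialDeriv {n k : ℕ} {F : Type*} [NormedAddCommGroup F] [NormedSpace ℝ F]
    (i : Fin k → Fin n) (f : EuclideanSpace ℝ (Fin n) → F) (ξ : EuclideanSpace ℝ (Fin n)) : F :=
  iteratedFDeriv ℝ k f ξ (fun j => EuclideanSpace.single (i j) (1 : ℝ))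

/-- `⟨ξ⟩ = (1 + |ξ|²)^{1/2}`. -/
def japaneseBracket {n : ℕ} (ξ : EuclideanSpace ℝ (Fin n)) : ℝ :=
  (1 + ‖ξ‖ ^ 2) ^ (1 / 2 : ℝ)

/-- The class `L^∞ S^m_ρ` of rough amplitudes `a(x, ξ)`, written `a x ξ`. Lebesgue measurability
in `x` is `AEMeasurable`. Boundedness in `x` for fixed `ξ` is the case `k = 0` of the last field. -/
structure IsRoughAmplitude {n : ℕ} (m ρ : ℝ)
    (a : EuclideanSpace ℝ (Fin n) → EuclideanSpace ℝ (Fin n) → ℂ) : Prop where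
  smooth : ∀ x, ContDiff ℝ ∞ (a x)
  measurable : ∀ ξ, AEMeasurable (fun x => a x ξ) volume
  bound : ∀ (k : ℕ) (i : Fin k → Fin n),
    (⨆ ξ : EuclideanSpace ℝ (Fin n),
      ENNReal.ofReal (japaneseBracket ξ ^ (-m + ρ * k)) *
        eLpNorm (fun x => partialDeriv i (a x) ξ) (⊤ : ℝ≥0∞) volume) < (⊤ : ℝ≥0∞)

/-- The class `L^∞ Φ^k` of rough phases `φ(x, ξ)`, written `φ x ξ`: real valued, smooth and
positively homogeneous of degree one in `ξ ≠ 0`, measurable in `x`, with bounds on the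
`ξ`-derivatives of order at least `k`. The phase itself is not required to be bounded in `x`
(the model phase `t(x)|ξ| + ⟨x, ξ⟩` with `t` bounded belongs to `L^∞ Φ^2`). -/
structure IsRoughPhase {n : ℕ} (k : ℕ)
    (φ : EuclideanSpace ℝ (Fin n) → EuclideanSpace ℝ (Fin n) → ℝ) : Prop where
  smooth : ∀ x, ContDiffOn ℝ ∞ (φ x) {0}ᶜ
  homogeneous : ∀ x ξ, ξ ≠ 0 → ∀ t : ℝ, 0 < t → φ x (t • ξ) = t * φ x ξ
  measurable : ∀ ξ, ξ ≠ 0 → AEMeasurable (fun x => φ x ξ) volume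
  bound : ∀ (l : ℕ) (i : Fin l → Fin n), k ≤ l →
    (⨆ (ξ : EuclideanSpace ℝ (Fin n)) (_ : ξ ≠ 0),
      ENNReal.ofReal (‖ξ‖ ^ (-1 + (l : ℝ))) *
        eLpNorm (fun x => partialDeriv i (φ x) ξ) (⊤ : ℝ≥0∞) volume) < (⊤ : ℝ≥0∞)

/-- The rough non-degeneracy condition. -/
structure IsRoughNondegenerate {n : ℕ}
    (φ : EuclideanSpace ℝ (Fin n) → EuclideanSpace ℝ (Fin n) → ℝ) : Prop where
  contDiffOn : ∀ x, ContDiffOn ℝ 1 (φ x) {0}ᶜ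
  measurable : ∀ ξ, ξ ≠ 0 → AEMeasurable (fun x => φ x ξ) volume
  lower_bound : ∃ c : ℝ, 0 < c ∧ ∀ x y ξ, ξ ≠ 0 →
    c * ‖x - y‖ ≤ ‖gradient (φ x) ξ - gradient (φ y) ξ‖

/-- The Fourier transform `û(ξ) = ∫ e^{-i⟨y, ξ⟩} u(y) dy`. -/
def fourierHat {n : ℕ} (u : EuclideanSpace ℝ (Fin n) → ℂ) (ξ : EuclideanSpace ℝ (Fin n)) : ℂ :=
  ∫ y, Complex.exp (-(Complex.I * (inner ℝ y ξ : ℝ))) * u y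

/-- The integrand `e^{iφ(x, ξ)} a(x, ξ) û(ξ)`. -/
def fioIntegrand {n : ℕ} (a : EuclideanSpace ℝ (Fin n) → EuclideanSpace ℝ (Fin n) → ℂ)
    (φ : EuclideanSpace ℝ (Fin n) → EuclideanSpace ℝ (Fin n) → ℝ)
    (u : EuclideanSpace ℝ (Fin n) → ℂ) (x ξ : EuclideanSpace ℝ (Fin n)) : ℂ :=
  Complex.exp (Complex.I * (φ x ξ : ℝ)) * a x ξ * fourierHat u ξ

/-- The Fourier integral operator
`T u(x) = (2π)^{-n} ∫ e^{iφ(x, ξ)} a(x, ξ) û(ξ) dξ`. -/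
def fourierIntegralOperator {n : ℕ}
    (a : EuclideanSpace ℝ (Fin n) → EuclideanSpace ℝ (Fin n) → ℂ)
    (φ : EuclideanSpace ℝ (Fin n) → EuclideanSpace ℝ (Fin n) → ℝ)
    (u : EuclideanSpace ℝ (Fin n) → ℂ) (x : EuclideanSpace ℝ (Fin n)) : ℂ :=
  ((2 * Real.pi : ℝ) : ℂ)⁻¹ ^ n * ∫ ξ, fioIntegrand a φ u x ξ

end

/-! ### Plancherel identity for integrable, square-integrable functions -/

section Plancherel

open FourierTransform SchwartzMap

variable {n : ℕ}

/-! Frequency space is cut into cells on which the operator is, up to a harmless factor, a Fourier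
integral evaluated at a point z(x). For a cell with reference vector v₀, put z(x) = ∇_ξ φ(x, v₀).
Homogeneity and Euler's identity give φ(x, ξ) = ⟨z(x), ξ⟩ + remainder, and at frequency λ and
angular width δ the remainder is O(λδ²). If λδ² is bounded and both the radial length and λδ are
O(λ^ρ), then e^{i·remainder} a(x, ·), in coordinates t ∈ [0, 1]^n on the cell, has all derivatives
up to order n of size O(λ^m), uniformly for almost every x (`norm_iteratedFDeriv_cellAmplitude_le`).

This factor depends on x without any regularity, so it is removed pointwise in x. Iterating the
fundamental theorem of calculus writes it as a superposition of indicators of {s < t}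
(`enorm_integral_comp_mul_le`). Hence the square of the cell's contribution at x is at most C λ^{2m}
Y(z(x)), where Y is a mean square of Fourier integrals of truncations of û and knows nothing about
x. Plancherel bounds ∫ Y (`lintegral_truncatedSquare_le`). Rough non-degeneracy makes z expansive,
so it pushes Lebesgue measure to at most c^{-n} times Lebesgue measure
(`exists_map_le_smul_volume`), and ∫ Y(z(x)) dx is controlled as well.

No orthogonality between the outputs of different cells is used: they are added by Cauchy–Schwarz
with weights λ^{2m}, while the inputs are disjoint pieces of û. There are O(λ^{n(1-ρ)+(n-1)/2})
cells at scale λ, so the weights are summable over dyadic λ under the hypothesis on m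
(`exists_frequencyCells`). -/

/-- The unnormalised inverse Fourier integral `y ↦ ∫ e^{i⟨y, ξ⟩} g(ξ) dξ`. -/
noncomputable def oscIntegral (g : EuclideanSpace ℝ (Fin n) → ℂ) (y : EuclideanSpace ℝ (Fin n)) : ℂ :=
  ∫ ξ, Complex.exp (Complex.I * (inner ℝ y ξ : ℝ)) * g ξ

/-- Both sides are locally integrable and agree as tempered distributions: against a test function,
each moves the transform onto the test function. -/
theorem fourier_toLp_ae_eq {g : EuclideanSpace ℝ (Fin n) → ℂ} (h1 : Integrable g)
    (h2 : MemLp g 2) : (𝓕 (h2.toLp g) : Lp ℂ 2 (volume : Measure (EuclideanSpace ℝ (Fin n))))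
      =ᵐ[volume] 𝓕 g := by
  have hcont : Continuous (𝓕 g) :=
    VectorFourier.fourierIntegral_continuous Real.continuous_fourierChar
      (by exact continuous_inner) h1
  refine ae_eq_of_integral_contDiff_smul_eq ?_ hcont.locallyIntegrable ?_
  · exact (Lp.memLp _).locallyIntegrable (by norm_num)
  intro ψ hψ hψc
  have hc : HasCompactSupport (fun x => (ψ x : ℂ)) := hψc.comp_left (g := fun t : ℝ => (t : ℂ)) (by simp)
  have hs : ContDiff ℝ ∞ (fun x => (ψ x : ℂ)) := Complex.ofRealCLM.contDiff.comp hψ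
  let Ψ : 𝓢(EuclideanSpace ℝ (Fin n), ℂ) := hc.toSchwartzMap hs
  have h := DFunLike.congr_fun (Lp.fourier_toTemperedDistribution_eq (h2.toLp g)) Ψ
  rw [TemperedDistribution.fourier_apply, Lp.toTemperedDistribution_apply,
    Lp.toTemperedDistribution_apply] at h
  have e1 : ∫ x, ψ x • (𝓕 (h2.toLp g) : Lp ℂ 2 (volume : Measure (EuclideanSpace ℝ (Fin n)))) x
      = ∫ x, Ψ x • (𝓕 (h2.toLp g) : Lp ℂ 2 (volume : Measure (EuclideanSpace ℝ (Fin n)))) x := by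
    refine integral_congr_ae (ae_of_all _ fun x => ?_)
    simp [Ψ]
  have e2 : ∫ x, (𝓕 Ψ) x • (h2.toLp g) x = ∫ x, (𝓕 Ψ) x • g x := by
    refine integral_congr_ae ?_
    filter_upwards [h2.coeFn_toLp] with x hx
    rw [hx]
  have e3 : ∫ x, (𝓕 Ψ) x • g x = ∫ x, Ψ x • (𝓕 g) x := by
    rw [SchwartzMap.fourier_coe]
    exact VectorFourier.integral_bilin_fourierIntegral_eq_flip (.mul ℂ ℂ) (L := innerₗ _)
      Real.continuous_fourierChar (by exact continuous_inner) Ψ.integrable h1 |>.trans (by simp [Real.fourier_eq]; rfl)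
  rw [e1, ← h, e2, e3]
  refine integral_congr_ae (ae_of_all _ fun x => ?_)
  simp [Ψ]

theorem lintegral_enorm_fourier_sq {g : EuclideanSpace ℝ (Fin n) → ℂ} (h1 : Integrable g)
    (h2 : MemLp g 2) : ∫⁻ y, ‖(𝓕 g) y‖ₑ ^ 2 = ∫⁻ ξ, ‖g ξ‖ₑ ^ 2 := by
  have key : eLpNorm (𝓕 g) 2 volume = eLpNorm g 2 volume := by
    rw [← eLpNorm_congr_ae (fourier_toLp_ae_eq h1 h2), ← eLpNorm_congr_ae h2.coeFn_toLp,
      ← Lp.enorm_def, ← Lp.enorm_def, ← ofReal_norm, ← ofReal_norm,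
      Lp.norm_fourier_eq]
  rw [eLpNorm_eq_lintegral_rpow_enorm_toReal (by norm_num) (by norm_num),
    eLpNorm_eq_lintegral_rpow_enorm_toReal (by norm_num) (by norm_num)] at key
  simpa using ENNReal.rpow_left_injective (x := 1 / ENNReal.toReal 2) (by simp) key

theorem oscIntegral_eq_fourier (g : EuclideanSpace ℝ (Fin n) → ℂ) (y : EuclideanSpace ℝ (Fin n)) :
    oscIntegral g y = 𝓕 g ((-(2 * Real.pi)⁻¹ : ℝ) • y) := by
  rw [Real.fourier_eq', oscIntegral]
  congr 1 with ξ
  rw [smul_eq_mul, inner_smul_right, real_inner_comm y ξ]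
  congr 2
  have : (Real.pi : ℂ) ≠ 0 := by exact_mod_cast Real.pi_ne_zero
  push_cast
  field_simp

theorem lintegral_enorm_oscIntegral_sq {g : EuclideanSpace ℝ (Fin n) → ℂ} (h1 : Integrable g)
    (h2 : MemLp g 2) :
    ∫⁻ y, ‖oscIntegral g y‖ₑ ^ 2 = ENNReal.ofReal ((2 * Real.pi) ^ n) * ∫⁻ ξ, ‖g ξ‖ₑ ^ 2 := by
  have hcont : Continuous (𝓕 g) :=
    VectorFourier.fourierIntegral_continuous Real.continuous_fourierChar
      (by exact continuous_inner) h1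
  have hpi := Real.pi_pos
  simp_rw [oscIntegral_eq_fourier]
  rw [← lintegral_enorm_fourier_sq h1 h2]
  generalize 𝓕 g = G at hcont ⊢
  rw [← lintegral_map (f := fun y => ‖G y‖ₑ ^ 2)
      (g := fun y : EuclideanSpace ℝ (Fin n) => (-(2 * Real.pi)⁻¹ : ℝ) • y) (by fun_prop)
      (by fun_prop), Measure.map_addHaar_smul _ (by simp), lintegral_smul_measure]
  congr 2
  simp only [finrank_euclideanSpace, Fintype.card_fin, neg_inv, inv_pow, inv_inv, abs_pow, abs_neg]
  rw [abs_of_pos (by positivity)]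

theorem continuous_oscIntegral {g : EuclideanSpace ℝ (Fin n) → ℂ} (h1 : Integrable g) :
    Continuous (oscIntegral g) := by
  have hcont : Continuous (𝓕 g) :=
    VectorFourier.fourierIntegral_continuous Real.continuous_fourierChar
      (by exact continuous_inner) h1
  have : oscIntegral g = fun y => 𝓕 g ((-(2 * Real.pi)⁻¹ : ℝ) • y) :=
    funext (oscIntegral_eq_fourier g)
  rw [this]
  fun_prop

end Plancherel

/-! ### Change of variables for expansive maps -/

section Antilipschitz

variable {n : ℕ}

/-- A measurable expansive map pushes Lebesgue measure to a multiple of Lebesgue measure. -/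
theorem exists_map_le_smul_volume {c : ℝ} (hc : 0 < c) :
    ∃ K : ℝ≥0∞, K ≠ (⊤ : ℝ≥0∞) ∧ ∀ z : EuclideanSpace ℝ (Fin n) → EuclideanSpace ℝ (Fin n),
      AEMeasurable z → (∀ x y, c * ‖x - y‖ ≤ ‖z x - z y‖) →
      Measure.map z volume ≤ K • volume := by
  let μ : Measure (EuclideanSpace ℝ (Fin n)) := Measure.hausdorffMeasure n
  let κ := Measure.addHaarScalarFactor (volume : Measure (EuclideanSpace ℝ (Fin n))) μ
  have hκ : (volume : Measure (EuclideanSpace ℝ (Fin n))) = κ • μ :=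
    Measure.isAddLeftInvariant_eq_smul _ _
  refine ⟨((Real.toNNReal c⁻¹ : NNReal) : ℝ≥0∞) ^ (n : ℝ), by simp, fun z hz h => ?_⟩
  have hanti : AntilipschitzWith (Real.toNNReal c⁻¹) z := by
    refine AntilipschitzWith.of_le_mul_dist fun x y => ?_
    rw [dist_eq_norm, dist_eq_norm, Real.coe_toNNReal _ (by positivity), inv_mul_eq_div,
      le_div_iff₀ hc, mul_comm]
    exact h x y
  refine Measure.le_iff.2 fun s hs => ?_
  rw [Measure.map_apply_of_aemeasurable hz hs, Measure.smul_apply, hκ, Measure.smul_apply,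
    Measure.smul_apply]
  have := hanti.hausdorffMeasure_preimage_le (d := n) (by positivity) s
  simp only [ENNReal.smul_def, smul_eq_mul]
  calc (κ : ℝ≥0∞) * μ (z ⁻¹' s) ≤ κ * (((Real.toNNReal c⁻¹ : NNReal) : ℝ≥0∞) ^ (n : ℝ) * μ s) := by
        gcongr
    _ = _ := by ring

end Antilipschitz

/-! ### Elementary derivative bounds -/

section Calculus

variable {E F G : Type*} [NormedAddCommGroup E] [NormedSpace ℝ E] [NormedAddCommGroup F]
  [NormedSpace ℝ F] [NormedAddCommGroup G] [NormedSpace ℝ G]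

theorem norm_iteratedFDeriv_comp_affine_le {f : F → G} (hf : ContDiff ℝ ∞ f) (A : E →L[ℝ] F)
    (c : F) (k : ℕ) (t : E) :
    ‖iteratedFDeriv ℝ k (fun t => f (c + A t)) t‖ ≤ ‖A‖ ^ k * ‖iteratedFDeriv ℝ k f (c + A t)‖ := by
  have hg : ContDiff ℝ ∞ (fun y => f (c + y)) := hf.comp (contDiff_const.add contDiff_id)
  have h : (fun t => f (c + A t)) = (fun y => f (c + y)) ∘ A := rfl
  rw [h, A.iteratedFDeriv_comp_right hg t (by exact_mod_cast le_top), iteratedFDeriv_comp_add_left]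
  refine (ContinuousMultilinearMap.norm_compContinuousLinearMap_le _ _).trans ?_
  simp [mul_comm]

theorem norm_iteratedFDeriv_fderiv_apply_le {f : E → F} (hf : ContDiff ℝ ∞ f) (e : E) (k : ℕ)
    (t : E) :
    ‖iteratedFDeriv ℝ k (fun t => fderiv ℝ f t e) t‖ ≤ ‖e‖ * ‖iteratedFDeriv ℝ (k + 1) f t‖ := by
  rw [← norm_iteratedFDeriv_fderiv]
  refine norm_iteratedFDeriv_clm_apply_const (N := ∞) ?_ (by exact_mod_cast le_top)
  exact (hf.fderiv_right (m := ∞) (by simp)).contDiffAt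

end Calculus

/-! ### Replacing a smooth factor by sharp truncations -/

section Duality

/-- Lebesgue measure on `(0, 1]` together with a unit mass at `-1`. -/
noncomputable def anchoredMeasure : Measure ℝ := volume.restrict (Set.Ioc 0 1) + Measure.dirac (-1)

instance : IsFiniteMeasure anchoredMeasure := by
  unfold anchoredMeasure; infer_instance

theorem anchoredMeasure_univ : anchoredMeasure Set.univ = 2 := by
  simp [anchoredMeasure]; norm_num

theorem measurable_ite_lt {X : Type*} [MeasurableSpace X] {n : ℕ} {w : X → ℂ} (hwm : Measurable w)
    {τ : X → Fin n → ℝ} (hτ : Measurable τ) :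
    Measurable fun p : (Fin n → ℝ) × X => if ∀ i, p.1 i < τ p.2 i then w p.2 else 0 := by
  refine Measurable.ite ?_ (by fun_prop) measurable_const
  rw [Set.ofPred_forall]
  exact MeasurableSet.iInter fun i => measurableSet_lt (by fun_prop) (by fun_prop)

theorem integrable_ite {X : Type*} [MeasurableSpace X] {μ : Measure X} {w : X → ℂ}
    (hw : Integrable w μ) {p : X → Prop} [DecidablePred p] (hp : MeasurableSet {x | p x}) :
    Integrable (fun x => if p x then w x else 0) μ := by
  have : (fun x => if p x then w x else 0) = Set.indicator {x | p x} w := by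
    ext x; simp [Set.indicator_apply]
  rw [this]; exact hw.indicator hp

/-- In the first variable, B(τ₀, τ') = B(0, τ') + ∫₀¹ 1_{r < τ₀} ∂₀B(r, τ') dr; the other variables
follow by induction. The atom at -1 carries the boundary term, since -1 < τ₀ always holds. Each
variable is differentiated at most once, so order n suffices, and B enters the result only through
C. -/
theorem enorm_integral_comp_mul_le {X : Type*} [MeasurableSpace X] {μ : Measure X} [SFinite μ]
    (n : ℕ) : ∀ {w : X → ℂ}, Measurable w → Integrable w μ → ∀ {τ : X → Fin n → ℝ}, Measurable τ →
      (∀ x i, 0 ≤ τ x i ∧ τ x i ≤ 1) → ∀ {B : (Fin n → ℝ) → ℂ}, ContDiff ℝ ∞ B → ∀ {C : ℝ},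
      (∀ k ≤ n, ∀ t, (∀ i, 0 ≤ t i ∧ t i ≤ 1) → ‖iteratedFDeriv ℝ k B t‖ ≤ C) →
      ‖∫ x, B (τ x) * w x ∂μ‖ₑ ≤ ENNReal.ofReal C *
        ∫⁻ s, ‖∫ x, (if ∀ i, s i < τ x i then w x else 0) ∂μ‖ₑ
          ∂(Measure.pi fun _ : Fin n => anchoredMeasure) := by
  induction n with
  | zero =>
    intro w hwm hw τ hτ hτ01 B hB C hC
    have h0 := hC 0 le_rfl 0 (by simp)
    rw [norm_iteratedFDeriv_zero] at h0
    have : ∀ x, τ x = 0 := fun x => Subsingleton.elim _ _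
    simp only [this, integral_const_mul]
    simp only [IsEmpty.forall_iff, if_true, lintegral_const, Measure.pi_empty_univ, mul_one,
      enorm_mul]
    gcongr
    rw [← ofReal_norm]
    exact ENNReal.ofReal_le_ofReal h0
  | succ n ih =>
    intro w hwm hw τ hτ hτ01 B hB C hC
    have hC0 : 0 ≤ C := (norm_nonneg _).trans (hC 0 (by omega) 0 (by simp))
    -- The slice of the cube at first coordinate s is the affine image c s + A t, so derivatives on
    -- slices are controlled by those of B because A has norm at most 1.
    let A : (Fin n → ℝ) →L[ℝ] (Fin (n + 1) → ℝ) :=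
      ContinuousLinearMap.pi (Fin.cons 0 fun i => ContinuousLinearMap.proj i)
    have hA : ∀ t, A t = Fin.cons 0 t := by
      intro t; ext i; refine Fin.cases ?_ (fun i => ?_) i <;> simp [A]
    have hA1 : ‖A‖ ≤ 1 := by
      refine A.opNorm_le_bound zero_le_one fun t => ?_
      rw [hA, one_mul, pi_norm_le_iff_of_nonneg (norm_nonneg _)]
      intro i; refine Fin.cases ?_ (fun i => ?_) i
      · simp
      · simpa using norm_le_pi_norm t i
    let c : ℝ → Fin (n + 1) → ℝ := fun s => Fin.cons s 0
    have hcA : ∀ s t, c s + A t = Fin.cons s t := by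
      intro s t; rw [hA]; ext i; refine Fin.cases ?_ (fun i => ?_) i <;> simp [c]
    have hcube : ∀ s, 0 ≤ s → s ≤ 1 → ∀ t : Fin n → ℝ, (∀ i, 0 ≤ t i ∧ t i ≤ 1) →
        ∀ i, 0 ≤ (Fin.cons s t : Fin (n + 1) → ℝ) i ∧ (Fin.cons s t : Fin (n + 1) → ℝ) i ≤ 1 := by
      intro s h0 h1 t ht i; refine Fin.cases ?_ (fun i => ?_) i
      · simp [h0, h1]
      · simpa using ht i
    let e : Fin (n + 1) → ℝ := Pi.single 0 1
    have he : ‖e‖ ≤ 1 := by simp [e, Pi.norm_single]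
    let τ' : X → Fin n → ℝ := fun x => Fin.tail (τ x)
    have hτ' : Measurable τ' := measurable_pi_lambda _ fun i => (measurable_pi_apply _).comp hτ
    have hτ0 : Measurable fun x => τ x 0 := (measurable_pi_apply _).comp hτ
    have hτ'01 : ∀ x i, 0 ≤ τ' x i ∧ τ' x i ≤ 1 := fun x i => hτ01 x i.succ
    let D : (Fin (n + 1) → ℝ) → ℂ := fun t => fderiv ℝ B t e
    have hD : ContDiff ℝ ∞ D := (hB.fderiv_right (m := ∞) (by simp)).clm_apply contDiff_const
    have hpow : ∀ k, ‖A‖ ^ k ≤ 1 := fun k => pow_le_one₀ (norm_nonneg _) hA1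
    have hD_le : ∀ k ≤ n, ∀ t : Fin (n + 1) → ℝ, (∀ i, 0 ≤ t i ∧ t i ≤ 1) →
        ‖iteratedFDeriv ℝ k D t‖ ≤ C := by
      intro k hk t ht
      refine (norm_iteratedFDeriv_fderiv_apply_le hB e k t).trans ?_
      exact (mul_le_of_le_one_left (norm_nonneg _) he).trans (hC (k + 1) (by omega) t ht)
    have slice : ∀ {f : (Fin (n + 1) → ℝ) → ℂ}, ContDiff ℝ ∞ f →
        (∀ k ≤ n, ∀ t : Fin (n + 1) → ℝ, (∀ i, 0 ≤ t i ∧ t i ≤ 1) → ‖iteratedFDeriv ℝ k f t‖ ≤ C) →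
        ∀ s, 0 ≤ s → s ≤ 1 → ∀ {w : X → ℂ}, Measurable w → Integrable w μ →
        ‖∫ x, f (Fin.cons s (τ' x)) * w x ∂μ‖ₑ ≤ ENNReal.ofReal C *
          ∫⁻ s, ‖∫ x, (if ∀ i, s i < τ' x i then w x else 0) ∂μ‖ₑ
            ∂(Measure.pi fun _ : Fin n => anchoredMeasure) := by
      intro f hf hfC s h0 h1 w hwm hw
      have := ih hwm hw hτ' hτ'01 (B := fun t => f (c s + A t))
        (hf.comp (contDiff_const.add A.contDiff)) (C := C) ?_
      · simpa only [hcA] using this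
      intro k hk t ht
      refine (norm_iteratedFDeriv_comp_affine_le hf A (c s) k t).trans ?_
      rw [hcA]
      exact (mul_le_of_le_one_left (norm_nonneg _) (hpow k)).trans (hfC k hk _ (hcube s h0 h1 t ht))
    let J : ℝ → (Fin n → ℝ) → ℝ≥0∞ := fun r s =>
      ‖∫ x, (if ∀ i, (Fin.cons r s : Fin (n + 1) → ℝ) i < τ x i then w x else 0) ∂μ‖ₑ
    have hJeq : ∀ r s, J r s =
        ‖∫ x, (if ∀ i, s i < τ' x i then (if r < τ x 0 then w x else 0) else 0) ∂μ‖ₑ := by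
      intro r s
      simp only [J, Fin.forall_fin_succ, Fin.cons_zero, Fin.cons_succ, τ', Fin.tail]
      congr 2 with x
      split_ifs <;> simp_all
    have hJm : Measurable (Function.uncurry J) := by
      have h1 : StronglyMeasurable fun s : Fin (n + 1) → ℝ =>
          ∫ x, (if ∀ i, s i < τ x i then w x else 0) ∂μ :=
        ((measurable_ite_lt hwm hτ).stronglyMeasurable).integral_prod_right'
      have h2 : Measurable fun p : ℝ × (Fin n → ℝ) => (Fin.cons p.1 p.2 : Fin (n + 1) → ℝ) := by
        refine measurable_pi_lambda _ fun i => ?_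
        refine Fin.cases ?_ (fun i => ?_) i
        · simpa using measurable_fst
        · simp only [Fin.cons_succ]; fun_prop
      exact (h1.measurable.comp h2).enorm
    have hJm' : Measurable fun r => ∫⁻ s, J r s ∂(Measure.pi fun _ : Fin n => anchoredMeasure) :=
      hJm.lintegral_prod_right'
    have hsplit : ∫⁻ s, ‖∫ x, (if ∀ i, s i < τ x i then w x else 0) ∂μ‖ₑ
          ∂(Measure.pi fun _ : Fin (n + 1) => anchoredMeasure) =
        (∫⁻ r in Set.Ioc 0 1, ∫⁻ s, J r s ∂(Measure.pi fun _ : Fin n => anchoredMeasure)) +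
          ∫⁻ s, J (-1) s ∂(Measure.pi fun _ : Fin n => anchoredMeasure) := by
      have h := (measurePreserving_piFinSuccAbove (fun _ : Fin (n + 1) => anchoredMeasure) 0).symm
      rw [← h.lintegral_comp_emb (MeasurableEquiv.measurableEmbedding _)]
      have hsf : SFinite (Measure.pi (fun _ : Fin n => anchoredMeasure)) := inferInstance
      generalize Measure.pi (fun _ : Fin n => anchoredMeasure) = π at hJm' hsf ⊢
      have h1 : (∫⁻ r in Set.Ioc 0 1, ∫⁻ s, J r s ∂π) + ∫⁻ s, J (-1) s ∂π =
          ∫⁻ r, ∫⁻ s, J r s ∂π ∂anchoredMeasure := by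
        rw [anchoredMeasure, lintegral_add_measure, lintegral_dirac' _ hJm']
      have h2 : ∫⁻ p, Function.uncurry J p ∂(anchoredMeasure.prod π) =
          ∫⁻ r, ∫⁻ s, J r s ∂π ∂anchoredMeasure := lintegral_prod _ hJm.aemeasurable
      rw [h1, ← h2]
      refine lintegral_congr fun p => ?_
      simp [J, Function.uncurry, MeasurableEquiv.piFinSuccAbove, Fin.insertNthEquiv]
    have hBτ : ∀ x, B (τ x) = B (Fin.cons 0 (τ' x)) +
        ∫ r in Set.Ioc (0 : ℝ) 1, (if r < τ x 0 then D (Fin.cons r (τ' x)) else 0) := by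
      intro x
      have hder : ∀ r : ℝ, HasDerivAt (fun r => B (Fin.cons r (τ' x))) (D (Fin.cons r (τ' x))) r := by
        intro r
        have h1 : HasDerivAt (fun r : ℝ => (Fin.cons r (τ' x) : Fin (n + 1) → ℝ)) e r := by
          rw [hasDerivAt_pi]
          intro i; refine Fin.cases ?_ (fun i => ?_) i
          · simpa [e] using! hasDerivAt_id r
          · simpa [e] using hasDerivAt_const r (τ' x i)
        exact ((hB.differentiable (by simp)) _).hasFDerivAt.comp_hasDerivAt r h1
      have hcont : Continuous fun r : ℝ => D (Fin.cons r (τ' x)) := by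
        refine hD.continuous.comp (continuous_pi fun i => ?_)
        refine Fin.cases ?_ (fun i => ?_) i
        · simpa using! continuous_id
        · simpa using continuous_const
      have h2 := intervalIntegral.integral_eq_sub_of_hasDerivAt (a := 0) (b := τ x 0)
        (fun r _ => hder r) (hcont.intervalIntegrable _ _)
      have h3 : (Fin.cons (τ x 0) (τ' x) : Fin (n + 1) → ℝ) = τ x := Fin.cons_self_tail _
      rw [h3, intervalIntegral.integral_of_le (hτ01 x 0).1, integral_Ioc_eq_integral_Ioo] at h2
      have h4 : (fun r => if r < τ x 0 then D (Fin.cons r (τ' x)) else 0) =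
          Set.indicator (Set.Iio (τ x 0)) fun r => D (Fin.cons r (τ' x)) := by
        ext r; simp [Set.indicator_apply]
      have h5 : Set.Ioc (0 : ℝ) 1 ∩ Set.Iio (τ x 0) = Set.Ioo 0 (τ x 0) := by
        ext r; simp only [Set.mem_inter_iff, Set.mem_Ioc, Set.mem_Iio, Set.mem_Ioo]
        have := (hτ01 x 0).2
        constructor
        · rintro ⟨⟨h1, h2⟩, h3⟩; exact ⟨h1, h3⟩
        · rintro ⟨h1, h3⟩; exact ⟨⟨h1, by linarith⟩, h3⟩
      rw [h4, setIntegral_indicator measurableSet_Iio, h5, h2]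
      ring
    have hconsm : Measurable fun p : X × ℝ => (Fin.cons p.2 (τ' p.1) : Fin (n + 1) → ℝ) := by
      refine measurable_pi_lambda _ fun i => ?_
      refine Fin.cases ?_ (fun i => ?_) i
      · simpa using measurable_snd
      · simp only [Fin.cons_succ]; fun_prop
    have hint : Integrable (fun p : X × ℝ =>
        (if p.2 < τ p.1 0 then D (Fin.cons p.2 (τ' p.1)) else 0) * w p.1)
        (μ.prod (volume.restrict (Set.Ioc 0 1))) := by
      have hmeas : Measurable (fun p : X × ℝ =>
          (if p.2 < τ p.1 0 then D (Fin.cons p.2 (τ' p.1)) else 0)) :=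
        Measurable.ite (measurableSet_lt measurable_snd (by fun_prop))
          (hD.continuous.measurable.comp hconsm) measurable_const
      have hw1 : Integrable (fun p : X × ℝ => w p.1) (μ.prod (volume.restrict (Set.Ioc 0 1))) :=
        hw.comp_fst _
      refine Integrable.bdd_mul (c := C) hw1 hmeas.aestronglyMeasurable ?_
      -- The derivative bounds are known only on the cube, so r has to be confined to (0, 1] before
      -- they apply.
      have : ∀ᵐ p ∂(μ.prod ((volume : Measure ℝ).restrict (Set.Ioc 0 1))), p.2 ∈ Set.Ioc (0 : ℝ) 1 :=
        Measure.quasiMeasurePreserving_snd.ae (ae_restrict_mem measurableSet_Ioc)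
      filter_upwards [this] with p hp
      split_ifs
      · have := hD_le 0 (by omega) (Fin.cons p.2 (τ' p.1))
          (hcube _ hp.1.le hp.2 _ (hτ'01 _))
        rwa [norm_iteratedFDeriv_zero] at this
      · simpa using hC0
    have hint0 : Integrable (fun x => B (Fin.cons 0 (τ' x)) * w x) μ := by
      refine Integrable.bdd_mul (c := C) hw ?_ (ae_of_all _ fun x => ?_)
      · exact (hB.continuous.measurable.comp
          (hconsm.comp (measurable_id.prodMk measurable_const))).aestronglyMeasurable
      · have := hC 0 (by omega) (Fin.cons 0 (τ' x)) (hcube 0 le_rfl zero_le_one _ (hτ'01 _))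
        rwa [norm_iteratedFDeriv_zero] at this
    have hmain : ∫ x, B (τ x) * w x ∂μ = (∫ x, B (Fin.cons 0 (τ' x)) * w x ∂μ) +
        ∫ r in Set.Ioc (0 : ℝ) 1, ∫ x, D (Fin.cons r (τ' x)) * (if r < τ x 0 then w x else 0) ∂μ := by
      have e1 : ∀ x, B (τ x) * w x = B (Fin.cons 0 (τ' x)) * w x +
          ∫ r in Set.Ioc (0 : ℝ) 1, (if r < τ x 0 then D (Fin.cons r (τ' x)) else 0) * w x := by
        intro x; rw [hBτ x, add_mul, integral_mul_const]
      simp_rw [e1]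
      rw [integral_add hint0 hint.integral_prod_left, integral_integral_swap hint]
      congr 2 with r
      congr 1 with x
      split_ifs <;> simp
    rw [hmain, hsplit, mul_add, add_comm (ENNReal.ofReal C * _)]
    refine (enorm_add_le _ _).trans (add_le_add ?_ ?_)
    · refine (slice hB (fun k hk => hC k (by omega)) 0 le_rfl zero_le_one hwm hw).trans ?_
      simp only [hJeq]
      -- At the atom the condition on the first coordinate is void, so the boundary term sees the
      -- untruncated weight.
      have : ∀ x, -1 < τ x 0 := fun x => by linarith [(hτ01 x 0).1]
      simp [this]
    · refine (enorm_integral_le_lintegral_enorm _).trans ?_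
      rw [← lintegral_const_mul _ hJm']
      refine setLIntegral_mono' measurableSet_Ioc fun r hr => ?_
      have hp : MeasurableSet {x | r < τ x 0} := measurableSet_lt measurable_const hτ0
      refine (slice hD hD_le r hr.1.le hr.2 (Measurable.ite hp hwm measurable_const)
        (integrable_ite hw hp)).trans ?_
      simp only [hJeq]
      exact le_rfl

end Duality

/-! ### Mean squares of truncated Fourier integrals -/

section SquareFunction

theorem sq_lintegral_le_measure_univ_mul {X : Type*} [MeasurableSpace X] (μ : Measure X)
    {f : X → ℝ≥0∞} (hf : AEMeasurable f μ) :
    (∫⁻ x, f x ∂μ) ^ 2 ≤ μ Set.univ * ∫⁻ x, f x ^ 2 ∂μ := by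
  have h := ENNReal.lintegral_mul_le_Lp_mul_Lq μ Real.HolderConjugate.two_two
    (f := fun _ => 1) (g := f) aemeasurable_const hf
  simp only [Pi.mul_apply, one_mul, ENNReal.one_rpow, lintegral_const] at h
  calc (∫⁻ x, f x ∂μ) ^ 2
      ≤ (μ Set.univ ^ (1 / 2 : ℝ) * (∫⁻ x, f x ^ (2 : ℝ) ∂μ) ^ (1 / 2 : ℝ)) ^ 2 := by gcongr
    _ = _ := by
      rw [mul_pow, ← ENNReal.rpow_natCast, ← ENNReal.rpow_natCast, ← ENNReal.rpow_mul,
        ← ENNReal.rpow_mul]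
      norm_num

variable {n : ℕ}

/-- The mean square of the truncations `oscIntegral (g 1_{s < τ})` over the anchored cube. -/
noncomputable def truncatedSquare (τ : EuclideanSpace ℝ (Fin n) → Fin n → ℝ)
    (g : EuclideanSpace ℝ (Fin n) → ℂ) (y : EuclideanSpace ℝ (Fin n)) : ℝ≥0∞ :=
  ∫⁻ s, ‖oscIntegral (fun ξ => if ∀ i, s i < τ ξ i then g ξ else 0) y‖ₑ ^ 2
    ∂(Measure.pi fun _ : Fin n => anchoredMeasure)

variable {τ : EuclideanSpace ℝ (Fin n) → Fin n → ℝ} {g : EuclideanSpace ℝ (Fin n) → ℂ}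

theorem measurable_oscIntegral_truncated (hg : Measurable g) (hτ : Measurable τ) :
    Measurable fun p : EuclideanSpace ℝ (Fin n) × (Fin n → ℝ) =>
      oscIntegral (fun ξ => if ∀ i, p.2 i < τ ξ i then g ξ else 0) p.1 := by
  have h : Measurable fun q : (EuclideanSpace ℝ (Fin n) × (Fin n → ℝ)) × EuclideanSpace ℝ (Fin n) =>
      Complex.exp (Complex.I * (inner ℝ q.1.1 q.2 : ℝ)) *
        (if ∀ i, q.1.2 i < τ q.2 i then g q.2 else 0) := by
    refine Measurable.mul (by fun_prop) ?_
    exact (measurable_ite_lt hg hτ).comp (f := fun q : (EuclideanSpace ℝ (Fin n) × (Fin n → ℝ)) ×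
      EuclideanSpace ℝ (Fin n) => (q.1.2, q.2)) (by fun_prop)
  exact h.stronglyMeasurable.integral_prod_right'.measurable

theorem measurable_truncatedSquare (hg : Measurable g) (hτ : Measurable τ) :
    Measurable (truncatedSquare τ g) :=
  ((measurable_oscIntegral_truncated hg hτ).enorm.pow_const 2).lintegral_prod_right'

theorem anchoredCube_univ :
    (Measure.pi fun _ : Fin n => anchoredMeasure) Set.univ = 2 ^ n := by
  rw [Measure.pi_univ]; simp [anchoredMeasure_univ]

/-- Tonelli and Plancherel for each fixed s: truncation can only decrease the L² norm of g, and the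
anchored cube has total mass 2^n. -/
theorem lintegral_truncatedSquare_le (hg : Measurable g) (h1 : Integrable g) (h2 : MemLp g 2)
    (hτ : Measurable τ) :
    ∫⁻ y, truncatedSquare τ g y ≤
      2 ^ n * (ENNReal.ofReal ((2 * Real.pi) ^ n) * ∫⁻ ξ, ‖g ξ‖ₑ ^ 2) := by
  unfold truncatedSquare
  rw [lintegral_lintegral_swap
    ((measurable_oscIntegral_truncated hg hτ).enorm.pow_const 2).aemeasurable]
  calc _ ≤ ∫⁻ _, ENNReal.ofReal ((2 * Real.pi) ^ n) * (∫⁻ ξ, ‖g ξ‖ₑ ^ 2)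
          ∂(Measure.pi fun _ : Fin n => anchoredMeasure) := by
        refine lintegral_mono fun s => ?_
        have hs : MeasurableSet {ξ | ∀ i, s i < τ ξ i} := by
          rw [Set.ofPred_forall]
          exact MeasurableSet.iInter fun i => measurableSet_lt (by fun_prop) (by fun_prop)
        have e : (fun ξ => if ∀ i, s i < τ ξ i then g ξ else 0) =
            Set.indicator {ξ | ∀ i, s i < τ ξ i} g := by
          ext ξ; simp [Set.indicator_apply]
        simp only [e]
        rw [lintegral_enorm_oscIntegral_sq (h1.indicator hs) (h2.indicator hs)]
        gcongr with ξ
        exact enorm_indicator_le_enorm_self _ _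
    _ = _ := by rw [lintegral_const, anchoredCube_univ, mul_comm]

/-- Since B occurs on the right only through C, it may later vary arbitrarily with x while y is set
to a gradient depending on x. -/
theorem enorm_sq_integral_exp_le (hg : Measurable g) (h1 : Integrable g)
    (hτ : Measurable τ) (hτ01 : ∀ ξ i, 0 ≤ τ ξ i ∧ τ ξ i ≤ 1)
    {B : (Fin n → ℝ) → ℂ} (hB : ContDiff ℝ ∞ B) {C : ℝ}
    (hC : ∀ k ≤ n, ∀ t, (∀ i, 0 ≤ t i ∧ t i ≤ 1) → ‖iteratedFDeriv ℝ k B t‖ ≤ C)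
    (y : EuclideanSpace ℝ (Fin n)) :
    ‖∫ ξ, B (τ ξ) * (Complex.exp (Complex.I * (inner ℝ y ξ : ℝ)) * g ξ)‖ₑ ^ 2 ≤
      ENNReal.ofReal C ^ 2 * 2 ^ n * truncatedSquare τ g y := by
  have hw : Integrable fun ξ => Complex.exp (Complex.I * (inner ℝ y ξ : ℝ)) * g ξ := by
    refine h1.bdd_mul (c := 1) (by fun_prop) (ae_of_all _ fun ξ => ?_)
    rw [mul_comm, Complex.norm_exp_ofReal_mul_I]
  have h := enorm_integral_comp_mul_le n (μ := volume) (by fun_prop) hw hτ hτ01 hB hC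
  have e : ∀ s : Fin n → ℝ, (∫ ξ, (if ∀ i, s i < τ ξ i then
      Complex.exp (Complex.I * (inner ℝ y ξ : ℝ)) * g ξ else 0)) =
      oscIntegral (fun ξ => if ∀ i, s i < τ ξ i then g ξ else 0) y := by
    intro s
    unfold oscIntegral
    congr 1 with ξ
    by_cases h : ∀ i, s i < τ ξ i
    · simp only [if_pos h]
    · simp only [if_neg h, mul_zero]
  simp only [e] at h
  calc _ ≤ (ENNReal.ofReal C * ∫⁻ s, ‖oscIntegral (fun ξ => if ∀ i, s i < τ ξ i then g ξ else 0) y‖ₑ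
          ∂(Measure.pi fun _ : Fin n => anchoredMeasure)) ^ 2 := by gcongr
    _ ≤ ENNReal.ofReal C ^ 2 * (2 ^ n * truncatedSquare τ g y) := by
        rw [mul_pow]
        gcongr
        refine (sq_lintegral_le_measure_univ_mul _ ?_).trans (by rw [anchoredCube_univ]; rfl)
        exact ((measurable_oscIntegral_truncated hg hτ).enorm.comp measurable_prodMk_left).aemeasurable
    _ = _ := by ring

end SquareFunction

/-! ### From essential suprema of partial derivatives to bounds for almost every x -/

section DerivativeBounds

variable {n : ℕ} {F : Type*} [NormedAddCommGroup F] [NormedSpace ℝ F]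

theorem ContinuousMultilinearMap.norm_le_sum_single {k : ℕ}
    (f : ContinuousMultilinearMap ℝ (fun _ : Fin k => EuclideanSpace ℝ (Fin n)) F) :
    ‖f‖ ≤ ∑ i : Fin k → Fin n, ‖f fun j => EuclideanSpace.single (i j) (1 : ℝ)‖ := by
  refine f.opNorm_le_bound (by positivity) fun v => ?_
  have hv : ∀ j, v j = ∑ l, v j l • EuclideanSpace.single l (1 : ℝ) := by
    intro j
    simpa using ((EuclideanSpace.basisFun (Fin n) ℝ).sum_repr (v j)).symm
  have : f v = ∑ i : Fin k → Fin n, (∏ j, v j (i j)) •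
      f fun j => EuclideanSpace.single (i j) (1 : ℝ) := by
    conv_lhs => rw [show v = fun j => ∑ l, v j l • EuclideanSpace.single l (1 : ℝ) from funext hv]
    rw [ContinuousMultilinearMap.map_sum]
    refine Finset.sum_congr rfl fun i _ => ?_
    rw [ContinuousMultilinearMap.map_smul_univ]
  rw [this, Finset.sum_mul]
  refine (norm_sum_le _ _).trans (Finset.sum_le_sum fun i _ => ?_)
  rw [norm_smul, mul_comm, norm_prod]
  gcongr with j
  exact PiLp.norm_apply_le _ _

/-- The exceptional null set depends on ξ. A countable dense set of ξ leaves one null set, and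
continuity extends the inequality to all of U. -/
theorem ae_forall_mem_norm_le {F : Type*} [NormedAddCommGroup F] {X : Type*} [MeasurableSpace X] {μ : Measure X} {Y : Type*}
    [TopologicalSpace Y] [SecondCountableTopology Y] {D : X → Y → F} {b : Y → ℝ} {U : Set Y}
    (hD : ∀ x, ContinuousOn (D x) U) (hb : ContinuousOn b U)
    (h : ∀ ξ ∈ U, ∀ᵐ x ∂μ, ‖D x ξ‖ ≤ b ξ) : ∀ᵐ x ∂μ, ∀ ξ ∈ U, ‖D x ξ‖ ≤ b ξ := by
  obtain ⟨S, hSc, hSd⟩ := TopologicalSpace.exists_countable_dense U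
  have : ∀ᵐ x ∂μ, ∀ ξ ∈ S, ‖D x ξ‖ ≤ b ξ :=
    (ae_ball_iff hSc).2 fun ξ _ => h ξ ξ.2
  filter_upwards [this] with x hx
  have hcl : IsClosed {ξ : U | ‖D x ξ‖ ≤ b ξ} :=
    isClosed_le (continuousOn_iff_continuous_domRestrict.1 (hD x)).norm
      (continuousOn_iff_continuous_domRestrict.1 hb)
  intro ξ hξ
  exact (hcl.closure_subset_iff.2 hx) (hSd ⟨ξ, hξ⟩)

theorem ae_norm_le_of_weighted_eLpNorm_le {F : Type*} [NormedAddCommGroup F] {X : Type*} [MeasurableSpace X] {μ : Measure X}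
    {f : X → F} {w : ℝ} (hw : 0 < w) {M : ℝ≥0∞} (hM : M ≠ ⊤)
    (h : ENNReal.ofReal w * eLpNorm f (⊤ : ℝ≥0∞) μ ≤ M) : ∀ᵐ x ∂μ, ‖f x‖ ≤ M.toReal * w⁻¹ := by
  rw [eLpNorm_exponent_top] at h
  filter_upwards [ae_le_eLpNormEssSup (f := f) (μ := μ)] with x hx
  have h1 : ENNReal.ofReal (w * ‖f x‖) ≤ M := by
    rw [ENNReal.ofReal_mul hw.le, ofReal_norm]
    exact (mul_le_mul_right hx _).trans h
  have h2 := (ENNReal.ofReal_le_iff_le_toReal hM).1 h1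
  rw [← div_eq_mul_inv, le_div_iff₀ hw]
  linarith

theorem one_le_japaneseBracket (ξ : EuclideanSpace ℝ (Fin n)) : 1 ≤ japaneseBracket ξ :=
  Real.one_le_rpow (by nlinarith [sq_nonneg ‖ξ‖]) (by norm_num)

theorem norm_le_japaneseBracket (ξ : EuclideanSpace ℝ (Fin n)) : ‖ξ‖ ≤ japaneseBracket ξ := by
  rw [japaneseBracket, ← Real.sqrt_eq_rpow]
  exact Real.le_sqrt_of_sq_le (by linarith)

theorem continuous_japaneseBracket_rpow (s : ℝ) :
    Continuous fun ξ : EuclideanSpace ℝ (Fin n) => japaneseBracket ξ ^ s := by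
  have : Continuous (japaneseBracket (n := n)) := by
    unfold japaneseBracket
    exact (by fun_prop : Continuous fun ξ : EuclideanSpace ℝ (Fin n) => 1 + ‖ξ‖ ^ 2).rpow_const
      fun ξ => Or.inr (by norm_num)
  exact this.rpow_const fun ξ => Or.inl (zero_lt_one.trans_le (one_le_japaneseBracket ξ)).ne'

theorem ae_forall_norm_iteratedFDeriv_le {U : Set (EuclideanSpace ℝ (Fin n))} (hU : IsOpen U)
    {f : EuclideanSpace ℝ (Fin n) → EuclideanSpace ℝ (Fin n) → F}
    (hf : ∀ x, ContDiffOn ℝ ∞ (f x) U) {w : EuclideanSpace ℝ (Fin n) → ℝ} (hw : ContinuousOn w U)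
    (hw0 : ∀ ξ ∈ U, 0 < w ξ) (k : ℕ)
    (h : ∀ i : Fin k → Fin n, (⨆ (ξ : EuclideanSpace ℝ (Fin n)) (_ : ξ ∈ U), ENNReal.ofReal (w ξ) *
      eLpNorm (fun x => partialDeriv i (f x) ξ) (⊤ : ℝ≥0∞) volume) < (⊤ : ℝ≥0∞)) :
    ∃ C : ℝ, 0 ≤ C ∧ ∀ᵐ x, ∀ ξ ∈ U, ‖iteratedFDeriv ℝ k (f x) ξ‖ ≤ C * (w ξ)⁻¹ := by
  let M : (Fin k → Fin n) → ℝ≥0∞ := fun i => ⨆ (ξ : EuclideanSpace ℝ (Fin n)) (_ : ξ ∈ U),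
    ENNReal.ofReal (w ξ) * eLpNorm (fun x => partialDeriv i (f x) ξ) (⊤ : ℝ≥0∞) volume
  refine ⟨∑ i, (M i).toReal, by positivity, ?_⟩
  refine ae_forall_mem_norm_le (fun x => ?_) (continuousOn_const.mul (hw.inv₀ fun ξ hξ =>
    (hw0 ξ hξ).ne')) fun ξ hξ => ?_
  · refine ((hf x).continuousOn_iteratedFDerivWithin (m := k) (by exact_mod_cast le_top)
      hU.uniqueDiffOn).congr fun ξ hξ => (iteratedFDerivWithin_of_isOpen k hU hξ).symm
  · have : ∀ᵐ x, ∀ i : Fin k → Fin n, ‖partialDeriv i (f x) ξ‖ ≤ (M i).toReal * (w ξ)⁻¹ := by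
      refine ae_all_iff.2 fun i => ?_
      refine ae_norm_le_of_weighted_eLpNorm_le (hw0 ξ hξ) (h i).ne ?_
      exact le_iSup₂ (f := fun (ξ : EuclideanSpace ℝ (Fin n)) (_ : ξ ∈ U) =>
        ENNReal.ofReal (w ξ) * eLpNorm (fun x => partialDeriv i (f x) ξ) (⊤ : ℝ≥0∞) volume) ξ hξ
    filter_upwards [this] with x hx
    rw [Finset.sum_mul]
    exact (ContinuousMultilinearMap.norm_le_sum_single _).trans
      (Finset.sum_le_sum fun i _ => hx i)

theorem IsRoughAmplitude.ae_norm_iteratedFDeriv_le {m ρ : ℝ}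
    {a : EuclideanSpace ℝ (Fin n) → EuclideanSpace ℝ (Fin n) → ℂ} (ha : IsRoughAmplitude m ρ a)
    (k : ℕ) : ∃ C : ℝ, 0 ≤ C ∧ ∀ᵐ x, ∀ ξ,
      ‖iteratedFDeriv ℝ k (a x) ξ‖ ≤ C * japaneseBracket ξ ^ (m - ρ * k) := by
  have hpos := fun ξ : EuclideanSpace ℝ (Fin n) => zero_lt_one.trans_le (one_le_japaneseBracket ξ)
  obtain ⟨C, hC, h⟩ := ae_forall_norm_iteratedFDeriv_le isOpen_univ
    (fun x => (ha.smooth x).contDiffOn)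
    (w := fun ξ => japaneseBracket ξ ^ (-m + ρ * k)) (continuous_japaneseBracket_rpow _).continuousOn
    (fun ξ _ => Real.rpow_pos_of_pos (hpos ξ) _) k (fun i => by simpa using ha.bound k i)
  refine ⟨C, hC, ?_⟩
  filter_upwards [h] with x hx ξ
  have := hx ξ trivial
  rwa [← Real.rpow_neg (hpos ξ).le, neg_add, neg_neg, ← sub_eq_add_neg] at this

/-- For |ξ| ≥ 1 and k ≥ 1 the weight |ξ|^{k-1} is at least 1 and can be dropped. This region is
enough because the phase is evaluated only near faces of the unit cube. -/
theorem IsRoughPhase.ae_norm_iteratedFDeriv_le {l : ℕ}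
    {φ : EuclideanSpace ℝ (Fin n) → EuclideanSpace ℝ (Fin n) → ℝ} (hφ : IsRoughPhase l φ)
    {k : ℕ} (hlk : l ≤ k) (hk : 1 ≤ k) : ∃ C : ℝ, 0 ≤ C ∧ ∀ᵐ x, ∀ ξ, 1 ≤ ‖ξ‖ →
      ‖iteratedFDeriv ℝ k (φ x) ξ‖ ≤ C := by
  obtain ⟨C, hC, h⟩ := ae_forall_norm_iteratedFDeriv_le
    (U := ({0}ᶜ : Set (EuclideanSpace ℝ (Fin n)))) isOpen_compl_singleton hφ.smooth
    (w := fun ξ => ‖ξ‖ ^ (-1 + (k : ℝ)))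
    (continuousOn_id.norm.rpow_const fun ξ hξ => Or.inl (norm_ne_zero_iff.2 hξ))
    (fun ξ hξ => Real.rpow_pos_of_pos (norm_pos_iff.2 hξ) _) k
    (fun i => by simpa using hφ.bound k i hlk)
  refine ⟨C, hC, ?_⟩
  filter_upwards [h] with x hx ξ hξ
  have hk' : (1 : ℝ) ≤ k := by exact_mod_cast hk
  refine (hx ξ (by rintro rfl; simp at hξ; linarith)).trans ?_
  exact mul_le_of_le_one_right hC (inv_le_one_of_one_le₀ (Real.one_le_rpow hξ (by linarith)))

end DerivativeBounds

/-! ### Leibniz, chain rule and Taylor estimates -/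

section CellCalculus

variable {E F G : Type*} [NormedAddCommGroup E] [NormedSpace ℝ E] [NormedAddCommGroup F]
  [NormedSpace ℝ F] [NormedAddCommGroup G] [NormedSpace ℝ G]

theorem norm_iteratedFDeriv_comp_affine_le_of_isOpen {f : F → G} {U : Set F} (hU : IsOpen U)
    (hf : ContDiffOn ℝ ∞ f U) (A : E →L[ℝ] F) (c : F) (h : ∀ t, c + A t ∈ U) (k : ℕ) (t : E) :
    ‖iteratedFDeriv ℝ k (fun t => f (c + A t)) t‖ ≤ ‖A‖ ^ k * ‖iteratedFDeriv ℝ k f (c + A t)‖ := by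
  let V : Set F := (fun y => c + y) ⁻¹' U
  have hV : IsOpen V := hU.preimage (by fun_prop)
  have hg : ContDiffOn ℝ ∞ (fun y => f (c + y)) V :=
    hf.comp (contDiff_const.add contDiff_id).contDiffOn fun y hy => hy
  have hpre : A ⁻¹' V = Set.univ := Set.eq_univ_of_forall h
  have h1 := A.iteratedFDerivWithin_comp_right hg hV.uniqueDiffOn
    (by rw [hpre]; exact uniqueDiffOn_univ) (x := t) (h t) (i := k) (by exact_mod_cast le_top)
  rw [hpre, iteratedFDerivWithin_univ, iteratedFDerivWithin_of_isOpen k hV (h t),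
    iteratedFDeriv_comp_add_left] at h1
  change ‖iteratedFDeriv ℝ k ((fun y => f (c + y)) ∘ A) t‖ ≤ _
  rw [h1]
  refine (ContinuousMultilinearMap.norm_compContinuousLinearMap_le _ _).trans ?_
  simp [mul_comm]

theorem contDiff_affine (c : F) (A : E →L[ℝ] F) : ContDiff ℝ ∞ fun t => c + A t :=
  contDiff_const.add A.contDiff

theorem norm_iteratedFDeriv_affine_one (c : F) (A : E →L[ℝ] F) (t : E) :
    ‖iteratedFDeriv ℝ 1 (fun t => c + A t) t‖ = ‖A‖ := by
  rw [norm_iteratedFDeriv_one, fderiv_const_add, A.fderiv]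

theorem iteratedFDeriv_affine_add_two (c : F) (A : E →L[ℝ] F) (k : ℕ) (t : E) :
    iteratedFDeriv ℝ (k + 2) (fun t => c + A t) t = 0 := by
  rw [← norm_eq_zero, ← norm_iteratedFDeriv_fderiv]
  have : fderiv ℝ (fun t => c + A t) = fun _ => A := by
    ext1 t; rw [fderiv_const_add, A.fderiv]
  rw [this, iteratedFDeriv_succ_const]
  simp

/-- Only Leibniz terms with at most one derivative on each affine factor survive. The three
hypotheses cover them, and 2^k is the crude sum of the binomial coefficients. -/
theorem norm_iteratedFDeriv_affine_smul_le (r : ℝ) (l : E →L[ℝ] ℝ) (c : F) (A : E →L[ℝ] F) (t : E)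
    {M : ℝ} (h1 : |r + l t| * ‖A‖ ≤ M) (h2 : ‖l‖ * ‖c + A t‖ ≤ M) (h3 : ‖l‖ * ‖A‖ ≤ M) {k : ℕ}
    (hk : 1 ≤ k) :
    ‖iteratedFDeriv ℝ k (fun t => (r + l t) • (c + A t)) t‖ ≤ 2 ^ k * M := by
  have hM : 0 ≤ M := le_trans (by positivity) h3
  refine (norm_iteratedFDeriv_smul_le (contDiff_affine r l) (contDiff_affine c A) t
    (n := k) (by exact_mod_cast le_top)).trans ?_
  have : ∀ i ∈ Finset.range (k + 1), (k.choose i : ℝ) * ‖iteratedFDeriv ℝ i (fun t => r + l t) t‖ *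
      ‖iteratedFDeriv ℝ (k - i) (fun t => c + A t) t‖ ≤ (k.choose i : ℝ) * M := by
    intro i hi
    rw [mul_assoc]
    gcongr
    have hi' : i ≤ k := by simpa [Nat.lt_succ_iff] using hi
    rcases i with _ | _ | i
    · rcases k with _ | _ | k
      · omega
      · rw [Nat.sub_zero, norm_iteratedFDeriv_zero, zero_add, norm_iteratedFDeriv_affine_one]
        exact h1
      · rw [Nat.sub_zero, iteratedFDeriv_affine_add_two, norm_zero, mul_zero]; exact hM
    · rw [zero_add, norm_iteratedFDeriv_affine_one]
      rcases k with _ | _ | _ | k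
      · omega
      · rw [norm_iteratedFDeriv_zero]; exact h2
      · rw [show 0 + 1 + 1 - 1 = 1 from rfl, norm_iteratedFDeriv_affine_one]; exact h3
      · rw [show k + 1 + 1 + 1 - 1 = k + 2 by omega, iteratedFDeriv_affine_add_two, norm_zero,
          mul_zero]
        exact hM
    · rw [iteratedFDeriv_affine_add_two, norm_zero, zero_mul]; exact hM
  refine (Finset.sum_le_sum this).trans ?_
  rw [← Finset.sum_mul]
  have := Nat.sum_range_choose k
  have h : (∑ i ∈ Finset.range (k + 1), (k.choose i : ℝ)) = 2 ^ k := by exact_mod_cast this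
  rw [h]

theorem norm_iteratedFDeriv_mul_le_of_bound {A : Type*} [NormedRing A] [NormedAlgebra ℝ A]
    {f g : E → A} (hf : ContDiff ℝ ∞ f) (hg : ContDiff ℝ ∞ g) (t : E) (k : ℕ) {P Q : ℝ}
    (hP : ∀ i ≤ k, ‖iteratedFDeriv ℝ i f t‖ ≤ P) (hQ : ∀ i ≤ k, ‖iteratedFDeriv ℝ i g t‖ ≤ Q) :
    ‖iteratedFDeriv ℝ k (fun t => f t * g t) t‖ ≤ 2 ^ k * (P * Q) := by
  have hP0 : 0 ≤ P := (norm_nonneg _).trans (hP 0 (by omega))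
  refine (norm_iteratedFDeriv_mul_le hf hg t (n := k) (by exact_mod_cast le_top)).trans ?_
  have h : (∑ i ∈ Finset.range (k + 1), (k.choose i : ℝ)) = 2 ^ k := by
    exact_mod_cast Nat.sum_range_choose k
  rw [← h, Finset.sum_mul]
  refine Finset.sum_le_sum fun i hi => ?_
  rw [mul_assoc]
  have hi' : i ≤ k := by simpa [Nat.lt_succ_iff] using hi
  gcongr
  · exact hP i hi'
  · exact hQ _ (by omega)

/-- Writing f ∘ ψ = f(μ ·) ∘ (μ⁻¹ψ) balances the losses: derivatives of ψ of size μ are compensated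
by a gain of μ⁻¹ for each derivative of f. It serves for μ = λ^ρ and f the amplitude. -/
theorem norm_iteratedFDeriv_comp_le_of_scaled {f : F → G} {ψ : E → F} (hf : ContDiff ℝ ∞ f)
    (hψ : ContDiff ℝ ∞ ψ) (t : E) (k : ℕ) {μ W D : ℝ} (hμ : 0 < μ)
    (hW : ∀ j ≤ k, ‖iteratedFDeriv ℝ j f (ψ t)‖ * μ ^ j ≤ W)
    (hD : ∀ j, 1 ≤ j → j ≤ k → ‖iteratedFDeriv ℝ j ψ t‖ ≤ μ * D ^ j) :
    ‖iteratedFDeriv ℝ k (fun t => f (ψ t)) t‖ ≤ k.factorial * W * D ^ k := by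
  let S : F →L[ℝ] F := μ • ContinuousLinearMap.id ℝ F
  have hS : ‖S‖ ≤ μ := by
    refine S.opNorm_le_bound hμ.le fun x => ?_
    simp [S, norm_smul, abs_of_pos hμ]
  have e : (fun t => f (ψ t)) = (fun y => f (0 + S y)) ∘ (fun t => μ⁻¹ • ψ t) := by
    ext t; simp [S, smul_smul, mul_inv_cancel₀ hμ.ne']
  have hSψ : 0 + S (μ⁻¹ • ψ t) = ψ t := by
    simp [S, smul_smul, inv_mul_cancel₀ hμ.ne']
  rw [e]
  refine norm_iteratedFDeriv_comp_le (N := ∞) (hf.comp (contDiff_affine 0 S)) (hψ.const_smul _)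
    (by exact_mod_cast le_top) t (fun j hj => ?_) fun j h1 hj => ?_
  · refine (norm_iteratedFDeriv_comp_affine_le hf S 0 j _).trans (le_trans ?_ (hW j hj))
    rw [hSψ, mul_comm]
    gcongr
  · have : iteratedFDeriv ℝ j (fun t => μ⁻¹ • ψ t) t = μ⁻¹ • iteratedFDeriv ℝ j ψ t :=
      iteratedFDeriv_const_smul_apply (hψ.of_le (by exact_mod_cast le_top)).contDiffAt
    rw [this, norm_smul, Real.norm_of_nonneg (by positivity), inv_mul_le_iff₀ hμ]
    exact hD j h1 hj

theorem norm_iteratedFDeriv_cexp_le (k : ℕ) (y : ℝ) :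
    ‖iteratedFDeriv ℝ k (fun y : ℝ => Complex.exp (Complex.I * y)) y‖ ≤ 1 := by
  have h : ∀ k, iteratedDeriv k (fun y : ℝ => Complex.exp (Complex.I * y)) =
      fun y : ℝ => Complex.I ^ k * Complex.exp (Complex.I * y) := by
    intro k
    induction k with
    | zero => simp
    | succ k ih =>
      rw [iteratedDeriv_succ, ih]
      ext y
      have h1 : HasDerivAt (fun y : ℝ => Complex.I * (y : ℂ)) Complex.I y := by
        simpa using (Complex.ofRealCLM.hasDerivAt (x := y)).const_mul Complex.I
      rw [(h1.cexp.const_mul (Complex.I ^ k)).deriv]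
      ring
  rw [norm_iteratedFDeriv_eq_norm_iteratedDeriv, h]
  rw [norm_mul, mul_comm Complex.I, Complex.norm_exp_ofReal_mul_I]
  simp

/-- The first-order Taylor remainder of `f` at `0`. -/
noncomputable def taylorRemainder (f : E → ℝ) (t : E) : ℝ := f t - (f 0 + fderiv ℝ f 0 t)

theorem contDiff_taylorRemainder {f : E → ℝ} (hf : ContDiff ℝ ∞ f) :
    ContDiff ℝ ∞ (taylorRemainder f) := hf.sub (contDiff_affine _ _)

/-- From order 2 on the remainder has the same derivatives as f. Orders 1 and 0 follow by the mean
value inequality from the origin, as the remainder and its derivative vanish there. -/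
theorem norm_iteratedFDeriv_taylorRemainder_le {f : E → ℝ} (hf : ContDiff ℝ ∞ f) {S : Set E}
    (hS : Convex ℝ S) (h0 : (0 : E) ∈ S) (h1 : ∀ t ∈ S, ‖t‖ ≤ 1) {M : ℝ} {N : ℕ}
    (hM : ∀ k, 2 ≤ k → k ≤ N + 2 → ∀ t ∈ S, ‖iteratedFDeriv ℝ k f t‖ ≤ M) {k : ℕ} (hk : k ≤ N)
    {t : E} (ht : t ∈ S) : ‖iteratedFDeriv ℝ k (taylorRemainder f) t‖ ≤ M := by
  have hM0 : 0 ≤ M := (norm_nonneg _).trans (hM 2 le_rfl (by omega) t ht)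
  have hd : Differentiable ℝ f := hf.differentiable (by simp)
  have hd2 : Differentiable ℝ (fderiv ℝ f) :=
    (hf.fderiv_right (m := ∞) (by simp)).differentiable (by simp)
  have hfd : ∀ t, fderiv ℝ (taylorRemainder f) t = fderiv ℝ f t - fderiv ℝ f 0 := by
    intro t
    have : HasFDerivAt (taylorRemainder f) (fderiv ℝ f t - fderiv ℝ f 0) t :=
      (hd t).hasFDerivAt.sub ((fderiv ℝ f 0).hasFDerivAt.const_add (f 0))
    exact this.fderiv
  have hone : ∀ t ∈ S, ‖fderiv ℝ (taylorRemainder f) t‖ ≤ M := by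
    intro t ht
    rw [hfd]
    refine (hS.norm_image_sub_le_of_norm_fderiv_le (C := M) (fun x _ => hd2 x) (fun x hx => ?_)
      h0 ht).trans ?_
    · rw [← norm_iteratedFDeriv_one, norm_iteratedFDeriv_fderiv]
      exact hM 2 le_rfl (by omega) x hx
    · rw [sub_zero]; exact mul_le_of_le_one_right hM0 (h1 t ht)
  rcases k with _ | _ | k
  · rw [norm_iteratedFDeriv_zero]
    have hz : taylorRemainder f 0 = 0 := by simp [taylorRemainder]
    have := hS.norm_image_sub_le_of_norm_fderiv_le (C := M)
      (fun x _ => (contDiff_taylorRemainder hf).differentiable (by simp) x) hone h0 ht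
    rw [hz, sub_zero, sub_zero] at this
    exact this.trans (mul_le_of_le_one_right hM0 (h1 t ht))
  · rw [zero_add, norm_iteratedFDeriv_one]; exact hone t ht
  · have : taylorRemainder f = f - fun t => f 0 + fderiv ℝ f 0 t := rfl
    rw [this, iteratedFDeriv_sub (hf.of_le (by exact_mod_cast le_top))
      ((contDiff_affine _ _).of_le (by exact_mod_cast le_top)), Pi.sub_apply,
      iteratedFDeriv_affine_add_two, sub_zero]
    exact hM _ (by omega) (by omega) t ht

end CellCalculus

/-! ### Coordinates on a cell and the amplitude in them -/

section Cell

variable {n : ℕ}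

/-- The linear map `ℝ^n → ℝ^n` that annihilates the `i`-th coordinate. -/
noncomputable def faceProj (i : Fin n) : (Fin n → ℝ) →L[ℝ] EuclideanSpace ℝ (Fin n) :=
  (EuclideanSpace.equiv (Fin n) ℝ).symm.toContinuousLinearMap.comp
    (ContinuousLinearMap.pi fun k => if k = i then 0 else ContinuousLinearMap.proj k)

theorem faceProj_apply (i k : Fin n) (t : Fin n → ℝ) :
    faceProj i t k = if k = i then 0 else t k := by
  simp only [faceProj, ContinuousLinearMap.comp_apply]
  split_ifs with h <;> simp [h]

theorem norm_le_of_forall_abs_le {x : EuclideanSpace ℝ (Fin n)} {b : ℝ} (h : ∀ k, |x k| ≤ b) :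
    ‖x‖ ≤ n * b := by
  have := (EuclideanSpace.basisFun (Fin n) ℝ).sum_repr x
  rw [← this]
  refine (norm_sum_le _ _).trans ?_
  calc _ ≤ ∑ _k : Fin n, b := Finset.sum_le_sum fun k _ => by simpa [norm_smul] using h k
    _ = n * b := by simp

theorem norm_faceProj_le (i : Fin n) : ‖faceProj i‖ ≤ n := by
  refine (faceProj i).opNorm_le_bound (by positivity) fun t => norm_le_of_forall_abs_le fun k => ?_
  rw [faceProj_apply]
  split_ifs
  · simp
  · exact norm_le_pi_norm t k

/-- The parametrisation `t ↦ (r₀ + L t_i) (v₀ + δ P_i t)` of a cell. -/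
noncomputable def cellMap (i : Fin n) (v₀ : EuclideanSpace ℝ (Fin n)) (δ r₀ L : ℝ)
    (t : Fin n → ℝ) : EuclideanSpace ℝ (Fin n) :=
  (r₀ + (L • ContinuousLinearMap.proj (R := ℝ) (φ := fun _ : Fin n => ℝ) i) t) •
    (v₀ + (δ • faceProj i) t)

/-- The amplitude of the operator on a cell, after extraction of the linear part of the phase. -/
noncomputable def cellAmplitude (i : Fin n) (v₀ : EuclideanSpace ℝ (Fin n)) (δ r₀ L : ℝ)
    (f : EuclideanSpace ℝ (Fin n) → ℝ) (b : EuclideanSpace ℝ (Fin n) → ℂ) (t : Fin n → ℝ) : ℂ :=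
  Complex.exp (Complex.I * (((r₀ + (L • ContinuousLinearMap.proj (R := ℝ)
    (φ := fun _ : Fin n => ℝ) i) t) *
      taylorRemainder (fun t => f (v₀ + (δ • faceProj i) t)) t : ℝ) : ℂ)) *
    b (cellMap i v₀ δ r₀ L t)

theorem faceVector_apply_self (i : Fin n) (v₀ : EuclideanSpace ℝ (Fin n)) (δ : ℝ) (t : Fin n → ℝ) :
    (v₀ + (δ • faceProj i) t) i = v₀ i := by
  simp [faceProj_apply]

/-- The i-th coordinate stays ±1 for every t, not only on the cube. So the singularity of the phase
at the origin is never met and the cell functions are smooth on the whole parameter space. -/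
theorem one_le_norm_faceVector {i : Fin n} {v₀ : EuclideanSpace ℝ (Fin n)} (hv : |v₀ i| = 1) (δ : ℝ)
    (t : Fin n → ℝ) : 1 ≤ ‖v₀ + (δ • faceProj i) t‖ := by
  have := PiLp.norm_apply_le (v₀ + (δ • faceProj i) t) i
  rwa [faceVector_apply_self, Real.norm_eq_abs, hv] at this

theorem contDiff_comp_faceVector {i : Fin n} {v₀ : EuclideanSpace ℝ (Fin n)} (hv : |v₀ i| = 1)
    (δ : ℝ) {f : EuclideanSpace ℝ (Fin n) → ℝ} (hf : ContDiffOn ℝ ∞ f {0}ᶜ) :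
    ContDiff ℝ ∞ fun t => f (v₀ + (δ • faceProj i) t) := by
  rw [← contDiffOn_univ]
  refine hf.comp (contDiff_affine v₀ (δ • faceProj i)).contDiffOn fun t _ => ?_
  intro h
  have := one_le_norm_faceVector hv δ t
  rw [Set.mem_singleton_iff.1 h, norm_zero] at this
  linarith

theorem contDiff_cellMap (i : Fin n) (v₀ : EuclideanSpace ℝ (Fin n)) (δ r₀ L : ℝ) :
    ContDiff ℝ ∞ (cellMap i v₀ δ r₀ L) :=
  ContDiff.smul (f := fun t => r₀ + (L • ContinuousLinearMap.proj (R := ℝ)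
    (φ := fun _ : Fin n => ℝ) i) t) (g := fun t => v₀ + (δ • faceProj i) t)
    (contDiff_affine _ _) (contDiff_affine _ _)

theorem contDiff_cexp_I : ContDiff ℝ ∞ fun y : ℝ => Complex.exp (Complex.I * y) :=
  (contDiff_const.mul Complex.ofRealCLM.contDiff).cexp

theorem contDiff_cellAmplitude {i : Fin n} {v₀ : EuclideanSpace ℝ (Fin n)} (hv : |v₀ i| = 1)
    (δ r₀ L : ℝ) {f : EuclideanSpace ℝ (Fin n) → ℝ} (hf : ContDiffOn ℝ ∞ f {0}ᶜ)
    {b : EuclideanSpace ℝ (Fin n) → ℂ} (hb : ContDiff ℝ ∞ b) :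
    ContDiff ℝ ∞ (cellAmplitude i v₀ δ r₀ L f b) :=
  (contDiff_cexp_I.comp ((contDiff_affine _ _).mul
    (contDiff_taylorRemainder (contDiff_comp_faceVector hv δ hf)))).mul
    (hb.comp (contDiff_cellMap i v₀ δ r₀ L))

end Cell

/-! ### Uniform bounds and linearisation of the phase on a cell -/

section CellBound

variable {n : ℕ}

/-- The exponent is a radial factor O(λ) times a Taylor remainder O(δ²), hence O(1) since λδ² ≤ 4.
In the amplitude, each derivative of `cellMap` costs at most λ^ρ up to constants, and each
ξ-derivative of b gains λ^{-ρ}, leaving λ^m. -/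
theorem norm_iteratedFDeriv_cellAmplitude_le {i : Fin n} {v₀ : EuclideanSpace ℝ (Fin n)}
    (hv : |v₀ i| = 1) (hv1 : ∀ k, |v₀ k| ≤ 1) {δ r₀ L lam m ρ : ℝ} (hδ0 : 0 ≤ δ) (hδ2 : δ ≤ 2)
    (hr₀ : 0 ≤ r₀) (hL : 0 ≤ L) (hlam : 1 ≤ lam) (hrL : r₀ + L ≤ 2 * lam) (hLρ : L ≤ lam ^ ρ)
    (hlδ : lam * δ ^ 2 ≤ 4) (hlδρ : lam * δ ≤ 2 * lam ^ ρ) (hmax : lam ≤ max 1 r₀) (hm : m ≤ 0)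
    (hρ : 0 ≤ ρ) {f : EuclideanSpace ℝ (Fin n) → ℝ} (hf : ContDiffOn ℝ ∞ f {0}ᶜ)
    {b : EuclideanSpace ℝ (Fin n) → ℂ} (hb : ContDiff ℝ ∞ b) {Cf Cb : ℝ}
    (hCf : ∀ k, 2 ≤ k → k ≤ n + 2 → ∀ ξ, 1 ≤ ‖ξ‖ → ‖iteratedFDeriv ℝ k f ξ‖ ≤ Cf)
    (hCb : ∀ k ≤ n, ∀ ξ, ‖iteratedFDeriv ℝ k b ξ‖ ≤ Cb * japaneseBracket ξ ^ (m - ρ * k))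
    {k : ℕ} (hk : k ≤ n) {t : Fin n → ℝ} (ht : ∀ i, 0 ≤ t i ∧ t i ≤ 1) :
    ‖iteratedFDeriv ℝ k (cellAmplitude i v₀ δ r₀ L f b) t‖ ≤
      2 ^ n * ((n.factorial * 1 * (2 * (1 + 8 * ((2 * n) ^ (n + 2) * Cf))) ^ n) *
        (n.factorial * Cb * (8 * n) ^ n)) * lam ^ m := by
  have hn1 : (1 : ℝ) ≤ n := by exact_mod_cast (Fin.pos i)
  have hlam0 : 0 < lam := by linarith
  have hlρ : 0 < lam ^ ρ := Real.rpow_pos_of_pos hlam0 _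
  have hCf0 : 0 ≤ Cf := (norm_nonneg _).trans (hCf 2 le_rfl (by omega) _
    (one_le_norm_faceVector hv δ t))
  have hCb0 : 0 ≤ Cb := by
    have h := (norm_nonneg _).trans (hCb 0 (by omega) (0 : EuclideanSpace ℝ (Fin n)))
    have h2 : 0 < japaneseBracket (0 : EuclideanSpace ℝ (Fin n)) ^ (m - ρ * (0 : ℕ)) :=
      Real.rpow_pos_of_pos (zero_lt_one.trans_le (one_le_japaneseBracket _)) _
    exact nonneg_of_mul_nonneg_left h h2
  let S : Set (Fin n → ℝ) := {t | ∀ i, 0 ≤ t i ∧ t i ≤ 1}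
  have hSeq : S = Set.Icc 0 1 := by
    ext t; simp only [S, Set.mem_ofPred_eq, Set.mem_Icc, Pi.le_def, forall_and]; rfl
  have hS : Convex ℝ S := hSeq ▸ convex_Icc 0 1
  have h0S : (0 : Fin n → ℝ) ∈ S := by simp [S]
  have hS1 : ∀ t ∈ S, ‖t‖ ≤ 1 := fun t ht => (pi_norm_le_iff_of_nonneg zero_le_one).2 fun j => by
    rw [Real.norm_eq_abs, abs_of_nonneg (ht j).1]; exact (ht j).2
  have hA : ‖δ • faceProj i‖ ≤ δ * n := by
    rw [norm_smul, Real.norm_of_nonneg hδ0]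
    gcongr
    exact norm_faceProj_le i
  let l : (Fin n → ℝ) →L[ℝ] ℝ := L • ContinuousLinearMap.proj (R := ℝ) (φ := fun _ : Fin n => ℝ) i
  have hl : ‖l‖ ≤ L := by
    refine l.opNorm_le_bound hL fun t => ?_
    simp only [l, _root_.smul_apply, ContinuousLinearMap.proj_apply, norm_smul,
      Real.norm_of_nonneg hL]
    gcongr
    exact norm_le_pi_norm t i
  have hlt : ∀ t ∈ S, 0 ≤ l t ∧ l t ≤ L := by
    intro t ht
    simp only [l, _root_.smul_apply, ContinuousLinearMap.proj_apply, smul_eq_mul]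
    exact ⟨mul_nonneg hL (ht i).1, mul_le_of_le_one_right hL (ht i).2⟩
  have hR0 : r₀ ≤ r₀ + l t := by linarith [(hlt t ht).1]
  have hR : |r₀ + l t| ≤ 2 * lam := by
    rw [abs_of_nonneg (by linarith)]; linarith [(hlt t ht).2]
  let g : (Fin n → ℝ) → ℝ := taylorRemainder fun t => f (v₀ + (δ • faceProj i) t)
  have hFs := contDiff_comp_faceVector hv δ hf
  have hg : ContDiff ℝ ∞ g := contDiff_taylorRemainder hFs
  have hgb : ∀ j ≤ n, ‖iteratedFDeriv ℝ j g t‖ ≤ δ ^ 2 * ((2 * n) ^ (n + 2) * Cf) := by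
    intro j hj
    refine norm_iteratedFDeriv_taylorRemainder_le hFs hS h0S hS1 (N := n) ?_ hj ht
    intro q hq2 hqn t _
    refine (norm_iteratedFDeriv_comp_affine_le_of_isOpen isOpen_compl_singleton hf (δ • faceProj i)
      v₀ (fun t => ?_) q t).trans ?_
    · intro h
      have := one_le_norm_faceVector hv δ t
      rw [Set.mem_singleton_iff.1 h, norm_zero] at this
      linarith
    · have h1 := hCf q hq2 hqn _ (one_le_norm_faceVector hv δ t)
      -- Two powers of δ are kept, to be absorbed by λ later; the remaining p are bounded using δ ≤
      -- 2.
      obtain ⟨p, rfl⟩ : ∃ p, q = p + 2 := ⟨q - 2, by omega⟩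
      have h2 : (δ * n) ^ (p + 2) ≤ δ ^ 2 * (2 * n) ^ (n + 2) := by
        calc (δ * n) ^ (p + 2) = δ ^ 2 * (δ ^ p * n ^ (p + 2)) := by ring
          _ ≤ δ ^ 2 * (2 ^ (p + 2) * n ^ (p + 2)) := by
            gcongr
            calc δ ^ p ≤ 2 ^ p := by gcongr
              _ ≤ 2 ^ (p + 2) := by gcongr <;> norm_num
          _ = δ ^ 2 * (2 * n) ^ (p + 2) := by rw [mul_pow]
          _ ≤ δ ^ 2 * (2 * n) ^ (n + 2) := by
            gcongr
            linarith
      calc _ ≤ (δ * n) ^ (p + 2) * Cf := by gcongr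
        _ ≤ (δ ^ 2 * (2 * n) ^ (n + 2)) * Cf := by gcongr
        _ = _ := by ring
  have hRb : ∀ j ≤ n, ‖iteratedFDeriv ℝ j (fun t => r₀ + l t) t‖ ≤ 2 * lam := by
    intro j _
    rcases j with _ | _ | j
    · rw [norm_iteratedFDeriv_zero]; exact hR
    · rw [zero_add, norm_iteratedFDeriv_affine_one]; linarith
    · rw [iteratedFDeriv_affine_add_two, norm_zero]; positivity
  set G : ℝ := (2 * n) ^ (n + 2) * Cf with hG
  have hG0 : 0 ≤ G := by positivity
  have hRg : ∀ j, 1 ≤ j → j ≤ n →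
      ‖iteratedFDeriv ℝ j (fun t => (r₀ + l t) * g t) t‖ ≤ (2 * (1 + 8 * G)) ^ j := by
    intro j hj1 hjn
    refine (norm_iteratedFDeriv_mul_le_of_bound (contDiff_affine r₀ l) hg t j
      (fun q hq => hRb q (by omega)) fun q hq => hgb q (by omega)).trans ?_
    rw [mul_pow]
    gcongr
    calc 2 * lam * (δ ^ 2 * G) = 2 * (lam * δ ^ 2) * G := by ring
      _ ≤ 2 * 4 * G := by gcongr
      _ ≤ 1 + 8 * G := by linarith
      _ ≤ (1 + 8 * G) ^ j := le_self_pow₀ (by linarith) (by omega)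
  have hE : ∀ j ≤ n, ‖iteratedFDeriv ℝ j
      (fun t => Complex.exp (Complex.I * (((r₀ + l t) * g t : ℝ) : ℂ))) t‖ ≤
      n.factorial * 1 * (2 * (1 + 8 * G)) ^ n := by
    intro j hj
    refine (norm_iteratedFDeriv_comp_le (g := fun y : ℝ => Complex.exp (Complex.I * y))
      (f := fun t => (r₀ + l t) * g t) (N := ∞) contDiff_cexp_I ((contDiff_affine r₀ l).mul hg)
      (n := j) (by exact_mod_cast le_top) t (C := 1) (D := 2 * (1 + 8 * G))
      (fun q _ => norm_iteratedFDeriv_cexp_le q _) fun q h1 h2 => hRg q h1 (by omega)).trans ?_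
    gcongr
    linarith
  have hV : ‖v₀ + (δ • faceProj i) t‖ ≤ 3 * n := by
    have h1 : ‖v₀‖ ≤ n * 1 := norm_le_of_forall_abs_le hv1
    have h2 := (δ • faceProj i).le_opNorm t
    have h3 := hS1 t ht
    have h4 : ‖δ • faceProj i‖ * ‖t‖ ≤ 2 * n * 1 := by
      gcongr
      exact hA.trans (by gcongr)
    linarith [norm_add_le v₀ ((δ • faceProj i) t)]
  have hψ : ∀ j, 1 ≤ j → j ≤ n →
      ‖iteratedFDeriv ℝ j (cellMap i v₀ δ r₀ L) t‖ ≤ lam ^ ρ * (8 * n) ^ j := by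
    intro j h1 _
    refine (norm_iteratedFDeriv_affine_smul_le r₀ l v₀ (δ • faceProj i) t (M := lam ^ ρ * (4 * n))
      ?_ ?_ ?_ h1).trans ?_
    · calc _ ≤ 2 * lam * (δ * n) := by gcongr
        _ = 2 * (lam * δ) * n := by ring
        _ ≤ 2 * (2 * lam ^ ρ) * n := by gcongr
        _ = _ := by ring
    · calc _ ≤ lam ^ ρ * (3 * n) := by gcongr; exact hl.trans hLρ
        _ ≤ _ := by gcongr; norm_num
    · calc _ ≤ lam ^ ρ * (2 * n) := by gcongr; exacts [hl.trans hLρ, hA.trans (by gcongr)]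
        _ ≤ _ := by gcongr; norm_num
    · calc (2 : ℝ) ^ j * (lam ^ ρ * (4 * n)) = lam ^ ρ * (2 ^ j * (4 * n)) := by ring
        _ ≤ lam ^ ρ * (2 ^ j * (4 * n) ^ j) := by
          gcongr
          exact le_self_pow₀ (by linarith) (by omega)
        _ = _ := by rw [← mul_pow]; ring
  -- If λ ≤ 1 this is the trivial bound on the bracket; otherwise λ ≤ r₀, and every point of the
  -- cell has norm at least r₀. With nonpositive exponent m - ρq, powers of the bracket are then
  -- bounded by powers of λ.
  have hbr : lam ≤ japaneseBracket (cellMap i v₀ δ r₀ L t) := by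
    refine hmax.trans (max_le (one_le_japaneseBracket _) ?_)
    refine le_trans ?_ (norm_le_japaneseBracket _)
    rw [cellMap, norm_smul, Real.norm_of_nonneg (by linarith)]
    exact hR0.trans (le_mul_of_one_le_right (by linarith) (one_le_norm_faceVector hv δ t))
  have hbA : ∀ j ≤ n, ‖iteratedFDeriv ℝ j (fun t => b (cellMap i v₀ δ r₀ L t)) t‖ ≤
      n.factorial * (Cb * lam ^ m) * (8 * n) ^ n := by
    intro j hj
    refine (norm_iteratedFDeriv_comp_le_of_scaled hb (contDiff_cellMap i v₀ δ r₀ L) t j hlρ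
      (W := Cb * lam ^ m) (D := 8 * n) (fun q hq => ?_)
      fun q h1 h2 => hψ q h1 (by omega)).trans ?_
    · have e : lam ^ m = lam ^ (m - ρ * q) * (lam ^ ρ) ^ q := by
        rw [← Real.rpow_natCast (lam ^ ρ), ← Real.rpow_mul hlam0.le, ← Real.rpow_add hlam0]
        congr 1; ring
      rw [e, ← mul_assoc]
      gcongr
      refine (hCb q (by omega) _).trans (mul_le_mul_of_nonneg_left ?_ hCb0)
      refine Real.rpow_le_rpow_of_nonpos hlam0 hbr ?_
      have : 0 ≤ ρ * q := by positivity
      linarith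
    · gcongr
      linarith
  have hmain := norm_iteratedFDeriv_mul_le_of_bound
    (contDiff_cexp_I.comp ((contDiff_affine r₀ l).mul hg))
    (hb.comp (contDiff_cellMap i v₀ δ r₀ L)) t k (fun q hq => hE q (by omega))
    fun q hq => hbA q (by omega)
  refine hmain.trans ?_
  calc _ ≤ (2 : ℝ) ^ n * (n.factorial * 1 * (2 * (1 + 8 * G)) ^ n *
        (n.factorial * (Cb * lam ^ m) * (8 * n) ^ n)) := by
        gcongr
        norm_num
    _ = _ := by ring

/-- Euler's identity, from differentiating f(tv) = t f(v) at t = 1. -/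
theorem fderiv_apply_self_of_homogeneous {E : Type*} [NormedAddCommGroup E] [NormedSpace ℝ E]
    {f : E → ℝ} {v : E} (hd : DifferentiableAt ℝ f v) (hh : ∀ t : ℝ, 0 < t → f (t • v) = t * f v) :
    fderiv ℝ f v v = f v := by
  have h1 : HasDerivAt (fun t : ℝ => t • v) v 1 := by
    simpa using (hasDerivAt_id (1 : ℝ)).smul_const v
  have h2 : HasDerivAt (fun t : ℝ => f (t • v)) (fderiv ℝ f v v) 1 := by
    refine HasFDerivAt.comp_hasDerivAt (1 : ℝ) ?_ h1
    simpa using hd.hasFDerivAt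
  have h3 : HasDerivAt (fun t : ℝ => f (t • v)) (f v) 1 := by
    have : HasDerivAt (fun t : ℝ => t * f v) (f v) 1 := by
      simpa using (hasDerivAt_id (1 : ℝ)).mul_const (f v)
    refine this.congr_of_eventuallyEq ?_
    filter_upwards [lt_mem_nhds zero_lt_one] with t ht using hh t ht
  exact h2.unique h3

/-- On a cell, the phase is linear up to the remainder that enters `cellAmplitude`. -/
theorem cexp_mul_eq_cellAmplitude_mul {i : Fin n} {v₀ : EuclideanSpace ℝ (Fin n)}
    (hv : |v₀ i| = 1) {δ r₀ L : ℝ} {f : EuclideanSpace ℝ (Fin n) → ℝ} (hf : ContDiffOn ℝ ∞ f {0}ᶜ)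
    (hh : ∀ ξ, ξ ≠ 0 → ∀ t : ℝ, 0 < t → f (t • ξ) = t * f ξ)
    (b : EuclideanSpace ℝ (Fin n) → ℂ) {t : Fin n → ℝ} (hR : 0 < r₀ + L * t i) :
    Complex.exp (Complex.I * (f (cellMap i v₀ δ r₀ L t) : ℝ)) * b (cellMap i v₀ δ r₀ L t) =
      cellAmplitude i v₀ δ r₀ L f b t *
        Complex.exp (Complex.I * (inner ℝ (gradient f v₀) (cellMap i v₀ δ r₀ L t) : ℝ)) := by
  have hv0 : v₀ ≠ 0 := by rintro rfl; simp at hv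
  have hd : DifferentiableAt ℝ f v₀ :=
    (hf.contDiffAt (isOpen_compl_singleton.mem_nhds hv0)).differentiableAt (by simp)
  have hV0 : v₀ + (δ • faceProj i) t ≠ 0 := by
    intro h
    have := one_le_norm_faceVector hv δ t
    rw [h, norm_zero] at this
    linarith
  have heul := fderiv_apply_self_of_homogeneous hd (hh v₀ hv0)
  have hF : HasFDerivAt (fun t => f (v₀ + (δ • faceProj i) t))
      ((fderiv ℝ f v₀).comp (δ • faceProj i)) 0 := by
    refine HasFDerivAt.comp (0 : Fin n → ℝ) ?_ ((δ • faceProj i).hasFDerivAt.const_add v₀)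
    simpa using hd.hasFDerivAt
  -- Homogeneity extracts the radial factor. Euler's identity turns the constant term f(v₀) into
  -- ⟨∇f(v₀), v₀⟩, so the first-order Taylor polynomial becomes exactly linear in ξ.
  have hkey : f (cellMap i v₀ δ r₀ L t) =
      (r₀ + (L • ContinuousLinearMap.proj (R := ℝ) (φ := fun _ : Fin n => ℝ) i) t) *
        taylorRemainder (fun t => f (v₀ + (δ • faceProj i) t)) t +
      inner ℝ (gradient f v₀) (cellMap i v₀ δ r₀ L t) := by
    rw [gradient, InnerProductSpace.toDual_symm_apply, taylorRemainder, hF.fderiv, cellMap,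
      hh _ hV0 _ (by simpa using hR), map_smul, map_add, heul]
    simp only [map_zero, add_zero, ContinuousLinearMap.comp_apply, smul_eq_mul]
    ring
  rw [cellAmplitude, mul_right_comm, ← Complex.exp_add, ← mul_add, ← Complex.ofReal_add, hkey]

end CellBound

/-! ### Frequency cells and the pointwise estimate on one cell -/

section FrequencyCell

/-- A cell of the frequency decomposition, in the coordinates of `cellMap`. The number `lam` is
comparable to the frequencies in the cell, and the inequalities make both the amplitude and the
phase remainder vary boundedly over the cell. -/
structure FrequencyCell (n : ℕ) (ρ : ℝ) where
  i : Fin n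
  v₀ : EuclideanSpace ℝ (Fin n)
  δ : ℝ
  r₀ : ℝ
  L : ℝ
  lam : ℝ
  abs_v₀_self : |v₀ i| = 1
  abs_v₀_le : ∀ k, |v₀ k| ≤ 1
  δ_pos : 0 < δ
  δ_le : δ ≤ 2
  r₀_nonneg : 0 ≤ r₀
  L_pos : 0 < L
  one_le_lam : 1 ≤ lam
  add_le : r₀ + L ≤ 2 * lam
  L_le : L ≤ lam ^ ρ
  lam_mul_sq_le : lam * δ ^ 2 ≤ 4
  lam_mul_le : lam * δ ≤ 2 * lam ^ ρ
  lam_le_max : lam ≤ max 1 r₀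

namespace FrequencyCell

variable {n : ℕ} {ρ : ℝ} (c : FrequencyCell n ρ)

/-- The inverse of `cellMap`. -/
noncomputable def coord (ξ : EuclideanSpace ℝ (Fin n)) (k : Fin n) : ℝ :=
  if k = c.i then (c.v₀ c.i * ξ c.i - c.r₀) / c.L
  else (ξ k / (c.v₀ c.i * ξ c.i) - c.v₀ k) / c.δ

/-- The set of frequencies in the cell. -/
def carrier : Set (EuclideanSpace ℝ (Fin n)) :=
  {ξ | 0 < c.v₀ c.i * ξ c.i ∧ ∀ k, 0 ≤ c.coord ξ k ∧ c.coord ξ k ≤ 1}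

open Classical in
/-- The cell coordinates, truncated to the cell. -/
noncomputable def param (ξ : EuclideanSpace ℝ (Fin n)) : Fin n → ℝ :=
  if ξ ∈ c.carrier then c.coord ξ else 0

theorem measurable_coord : Measurable c.coord := by
  refine measurable_pi_lambda _ fun k => ?_
  unfold coord
  split_ifs <;> fun_prop

theorem measurableSet_carrier : MeasurableSet c.carrier := by
  have h : ∀ k, Measurable fun ξ => c.coord ξ k := fun k =>
    (measurable_pi_apply k).comp c.measurable_coord
  have h0 : Measurable fun ξ : EuclideanSpace ℝ (Fin n) => c.v₀ c.i * ξ c.i := by fun_prop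
  have e : c.carrier = {ξ | 0 < c.v₀ c.i * ξ c.i} ∩
      ⋂ k, {ξ | 0 ≤ c.coord ξ k} ∩ {ξ | c.coord ξ k ≤ 1} := by
    ext ξ; simp [carrier]
  rw [e]
  exact (measurableSet_lt measurable_const h0).inter (MeasurableSet.iInter fun k =>
    (measurableSet_le measurable_const (h k)).inter (measurableSet_le (h k) measurable_const))

theorem measurable_param : Measurable c.param :=
  Measurable.ite c.measurableSet_carrier c.measurable_coord measurable_const

/-- The default value 0 off the carrier keeps the parameter in the cube for every ξ, as the
truncation argument demands; the weights used there vanish off the carrier. -/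
theorem param_mem (ξ : EuclideanSpace ℝ (Fin n)) (k : Fin n) :
    0 ≤ c.param ξ k ∧ c.param ξ k ≤ 1 := by
  unfold param
  split_ifs with h
  · exact h.2 k
  · simp

theorem cellMap_coord {ξ : EuclideanSpace ℝ (Fin n)} (h : 0 < c.v₀ c.i * ξ c.i) :
    cellMap c.i c.v₀ c.δ c.r₀ c.L (c.coord ξ) = ξ := by
  have hL := c.L_pos.ne'
  have hδ := c.δ_pos.ne'
  have hsq : c.v₀ c.i * c.v₀ c.i = 1 := by
    rw [← sq, ← sq_abs, c.abs_v₀_self, one_pow]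
  have hR : c.r₀ + c.L * c.coord ξ c.i = c.v₀ c.i * ξ c.i := by
    rw [coord, if_pos rfl]; field_simp; ring
  ext k
  rw [cellMap]
  simp only [_root_.smul_apply, ContinuousLinearMap.proj_apply, smul_eq_mul, PiLp.smul_apply,
    PiLp.add_apply, faceProj_apply, hR]
  by_cases hk : k = c.i
  · subst hk
    rw [if_pos rfl, mul_zero, add_zero, mul_right_comm, hsq, one_mul]
  · rw [if_neg hk, coord, if_neg hk, mul_div_cancel₀ _ hδ, add_sub_cancel, mul_div_cancel₀ _ h.ne']

/-- The constant in the amplitude bound on a cell. -/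
noncomputable def bound (n : ℕ) (Cf Cb : ℝ) : ℝ :=
  2 ^ n * ((n.factorial * 1 * (2 * (1 + 8 * ((2 * n) ^ (n + 2) * Cf))) ^ n) *
    (n.factorial * Cb * (8 * n) ^ n))

/-- For f = φ(x, ·) and b = a(x, ·) the truncated square is a fixed function, and x enters only
through the point ∇f(v₀) at which it is evaluated. -/
theorem enorm_sq_setIntegral_le {D : Set (EuclideanSpace ℝ (Fin n))} (hD : MeasurableSet D)
    (hDc : D ⊆ c.carrier) {w : EuclideanSpace ℝ (Fin n) → ℂ} (hwm : Measurable w)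
    (hw : Integrable w) {m : ℝ} (hm : m ≤ 0) (hρ : 0 ≤ ρ)
    {f : EuclideanSpace ℝ (Fin n) → ℝ} (hf : ContDiffOn ℝ ∞ f {0}ᶜ)
    (hh : ∀ ξ, ξ ≠ 0 → ∀ t : ℝ, 0 < t → f (t • ξ) = t * f ξ)
    {b : EuclideanSpace ℝ (Fin n) → ℂ} (hb : ContDiff ℝ ∞ b) {Cf Cb : ℝ}
    (hCf : ∀ k, 2 ≤ k → k ≤ n + 2 → ∀ ξ, 1 ≤ ‖ξ‖ → ‖iteratedFDeriv ℝ k f ξ‖ ≤ Cf)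
    (hCb : ∀ k ≤ n, ∀ ξ, ‖iteratedFDeriv ℝ k b ξ‖ ≤ Cb * japaneseBracket ξ ^ (m - ρ * k)) :
    ‖∫ ξ in D, Complex.exp (Complex.I * (f ξ : ℝ)) * b ξ * w ξ‖ₑ ^ 2 ≤
      ENNReal.ofReal (bound n Cf Cb * c.lam ^ m) ^ 2 * 2 ^ n *
        truncatedSquare c.param (D.indicator w) (gradient f c.v₀) := by
  have h := enorm_sq_integral_exp_le (hwm.indicator hD) (hw.indicator hD) c.measurable_param
    c.param_mem (contDiff_cellAmplitude c.abs_v₀_self c.δ c.r₀ c.L hf hb)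
    (C := bound n Cf Cb * c.lam ^ m) (fun k hk t ht =>
      norm_iteratedFDeriv_cellAmplitude_le c.abs_v₀_self c.abs_v₀_le c.δ_pos.le c.δ_le c.r₀_nonneg
        c.L_pos.le c.one_le_lam c.add_le c.L_le c.lam_mul_sq_le c.lam_mul_le c.lam_le_max hm hρ hf
        hb hCf hCb hk ht) (gradient f c.v₀)
  refine le_trans (le_of_eq ?_) h
  rw [← integral_indicator hD]
  congr 3 with ξ
  by_cases hξ : ξ ∈ D
  · have hc := hDc hξ
    have hR : c.r₀ + c.L * c.coord ξ c.i = c.v₀ c.i * ξ c.i := by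
      have := c.L_pos.ne'
      rw [coord, if_pos rfl]; field_simp; ring
    have e := cexp_mul_eq_cellAmplitude_mul c.abs_v₀_self (δ := c.δ) hf hh b (t := c.coord ξ)
      (by rw [hR]; exact hc.1)
    rw [c.cellMap_coord hc.1] at e
    rw [Set.indicator_of_mem hξ, Set.indicator_of_mem hξ, param, if_pos hc, e, mul_assoc]
  · rw [Set.indicator_of_notMem hξ, Set.indicator_of_notMem hξ, mul_zero, mul_zero]

end FrequencyCell

/-- Partial derivatives are limits of difference quotients along a sequence, each measurable in x.
-/
theorem aemeasurable_gradient {n : ℕ} {φ : EuclideanSpace ℝ (Fin n) → EuclideanSpace ℝ (Fin n) → ℝ}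
    (hφ : ∀ ξ, ξ ≠ 0 → AEMeasurable (fun x => φ x ξ) volume) {v : EuclideanSpace ℝ (Fin n)}
    (hv : v ≠ 0) (hd : ∀ x, DifferentiableAt ℝ (φ x) v) :
    AEMeasurable (fun x => gradient (φ x) v) volume := by
  have hcoord : ∀ k, AEMeasurable (fun x => gradient (φ x) v k) volume := by
    intro k
    let e : EuclideanSpace ℝ (Fin n) := EuclideanSpace.single k 1
    have hlim : Filter.Tendsto (fun N : ℕ => (1 / ((N : ℝ) + 1))) Filter.atTop (nhds 0) :=
      tendsto_one_div_add_atTop_nhds_zero_nat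
    have hv' : ∀ᶠ N : ℕ in Filter.atTop, v + (1 / ((N : ℝ) + 1)) • e ≠ 0 := by
      have : Filter.Tendsto (fun N : ℕ => v + (1 / ((N : ℝ) + 1)) • e) Filter.atTop (nhds v) := by
        simpa using (hlim.smul_const e).const_add v
      exact this.eventually_ne hv
    -- Starting the sequence at N₀ keeps the shifted points off the origin, where measurability of
    -- the phase is not assumed.
    obtain ⟨N₀, hN₀⟩ := Filter.eventually_atTop.1 hv'
    refine aemeasurable_of_tendsto_metrizable_ae Filter.atTop (f := fun (N : ℕ) x =>
      (1 / (((N + N₀ : ℕ) : ℝ) + 1))⁻¹ * (φ x (v + (1 / (((N + N₀ : ℕ) : ℝ) + 1)) • e) - φ x v))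
      (fun N => ?_) (ae_of_all _ fun x => ?_)
    · exact (((hφ _ (hN₀ _ (Nat.le_add_left _ _))).sub (hφ v hv)).const_mul _)
    · have h1 : HasDerivAt (fun t : ℝ => φ x (v + t • e)) (fderiv ℝ (φ x) v e) 0 := by
        have h2 : HasDerivAt (fun t : ℝ => v + t • e) e 0 := by
          simpa using ((hasDerivAt_id (0 : ℝ)).smul_const e).const_add v
        refine HasFDerivAt.comp_hasDerivAt (0 : ℝ) ?_ h2
        simpa using (hd x).hasFDerivAt
      have h3 : gradient (φ x) v k = fderiv ℝ (φ x) v e := by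
        have : inner ℝ (gradient (φ x) v) e = gradient (φ x) v k := by
          rw [EuclideanSpace.inner_single_right]; simp
        rw [← this, gradient, InnerProductSpace.toDual_symm_apply]
      have h4 := h1.tendsto_slope_zero
      simp only [zero_add, zero_smul, add_zero, smul_eq_mul] at h4
      rw [h3]
      refine h4.comp (tendsto_nhdsWithin_iff.2 ⟨?_, Filter.Eventually.of_forall fun N => ?_⟩)
      · exact hlim.comp (Filter.tendsto_add_atTop_nat N₀)
      · have : (0 : ℝ) < 1 / (((N + N₀ : ℕ) : ℝ) + 1) := by positivity
        exact this.ne'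
  exact (MeasurableEquiv.toLp 2 (Fin n → ℝ)).measurable.comp_aemeasurable
    (aemeasurable_pi_lambda (fun x k => gradient (φ x) v k) hcoord)

end FrequencyCell

/-! ### Cauchy–Schwarz for series and disjoint refinement -/

section Countable

theorem ENNReal.sq_tsum_le {ι : Type*} {a p y : ι → ℝ≥0∞} (h : ∀ i, a i ^ 2 ≤ p i * y i) :
    (∑' i, a i) ^ 2 ≤ (∑' i, p i) * ∑' i, y i := by
  let _ : MeasurableSpace ι := ⊤
  have hsq : ∀ t : ℝ≥0∞, (t ^ (1 / 2 : ℝ)) ^ (2 : ℝ) = t := fun t => by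
    rw [← ENNReal.rpow_mul]; norm_num
  have ha : ∀ i, a i ≤ p i ^ (1 / 2 : ℝ) * y i ^ (1 / 2 : ℝ) := by
    intro i
    rw [← ENNReal.mul_rpow_of_nonneg _ _ (by norm_num : (0 : ℝ) ≤ 1 / 2)]
    refine le_trans (le_of_eq ?_) (ENNReal.rpow_le_rpow (h i) (by norm_num))
    rw [← ENNReal.rpow_natCast, ← ENNReal.rpow_mul]; norm_num
  have hH := ENNReal.lintegral_mul_le_Lp_mul_Lq (Measure.count : Measure ι)
    Real.HolderConjugate.two_two (f := fun i => p i ^ (1 / 2 : ℝ)) (g := fun i => y i ^ (1 / 2 : ℝ))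
    measurable_from_top.aemeasurable measurable_from_top.aemeasurable
  simp only [lintegral_count, Pi.mul_apply, hsq] at hH
  calc (∑' i, a i) ^ 2 ≤ ((∑' i, p i) ^ (1 / 2 : ℝ) * (∑' i, y i) ^ (1 / 2 : ℝ)) ^ 2 := by
        gcongr
        exact (ENNReal.tsum_le_tsum ha).trans hH
    _ = _ := by
      rw [mul_pow, ← ENNReal.rpow_natCast, ← ENNReal.rpow_natCast, ← ENNReal.rpow_mul,
        ← ENNReal.rpow_mul]
      norm_num

/-- Closed cells overlap on their boundaries. Each point is assigned to the first set containing it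
in an enumeration. -/
theorem exists_measurable_disjoint_refinement {X ι : Type*} [MeasurableSpace X] [Countable ι]
    {Q : ι → Set X} (hQ : ∀ i, MeasurableSet (Q i)) :
    ∃ D : ι → Set X, (∀ i, MeasurableSet (D i)) ∧ (∀ i, D i ⊆ Q i) ∧
      Pairwise (Function.onFun Disjoint D) ∧ ⋃ i, D i = ⋃ i, Q i := by
  obtain ⟨e, he⟩ := exists_injective_nat ι
  refine ⟨fun i => Q i \ ⋃ (j : ι) (_ : e j < e i), Q j, fun i => ?_, fun i => Set.sdiff_subset,
    ?_, ?_⟩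
  · exact (hQ i).diff (MeasurableSet.iUnion fun j => MeasurableSet.iUnion fun _ => hQ j)
  · intro i j hij
    rw [Function.onFun, Set.disjoint_left]
    rintro x ⟨hxi, hxi'⟩ ⟨hxj, hxj'⟩
    simp only [Set.mem_iUnion, not_exists] at hxi' hxj'
    rcases lt_or_gt_of_ne (he.ne hij) with h | h
    · exact hxj' i h hxi
    · exact hxi' j h hxj
  · refine Set.Subset.antisymm (Set.iUnion_mono fun i => Set.sdiff_subset) fun x hx => ?_
    obtain ⟨i₀, hi₀⟩ := Set.mem_iUnion.1 hx
    obtain ⟨i, hi, hmin⟩ := (measure e).wf.has_min {i | x ∈ Q i} ⟨i₀, hi₀⟩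
    refine Set.mem_iUnion.2 ⟨i, hi, ?_⟩
    simp only [Set.mem_iUnion, not_exists]
    exact fun j hj hxj => hmin j hxj hj

end Countable

/-! ### The dyadic, radial and angular decomposition -/

section Decomposition

/-- The frequency scales `1, 1, 2, 4, 8, …`. -/
noncomputable def dyadicScale (j : ℕ) : ℝ := 2 ^ (j - 1)

/-- The left endpoints `0, 1, 2, 4, 8, …` of the dyadic intervals. -/
noncomputable def dyadicBase (j : ℕ) : ℝ := if j = 0 then 0 else dyadicScale j

theorem one_le_dyadicScale (j : ℕ) : 1 ≤ dyadicScale j := one_le_pow₀ (by norm_num)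

theorem dyadicScale_pos (j : ℕ) : 0 < dyadicScale j := zero_lt_one.trans_le (one_le_dyadicScale j)

theorem dyadicBase_nonneg (j : ℕ) : 0 ≤ dyadicBase j := by
  unfold dyadicBase; split_ifs; exacts [le_rfl, (dyadicScale_pos j).le]

theorem dyadicBase_le (j : ℕ) : dyadicBase j ≤ dyadicScale j := by
  unfold dyadicBase; split_ifs; exacts [(dyadicScale_pos j).le, le_rfl]

theorem dyadicScale_le_max (j : ℕ) : dyadicScale j ≤ max 1 (dyadicBase j) := by
  unfold dyadicBase
  split_ifs with h
  · subst h; simp [dyadicScale]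
  · exact le_max_right _ _

theorem exists_dyadic_interval {r : ℝ} (hr : 0 ≤ r) :
    ∃ j, dyadicBase j ≤ r ∧ r ≤ dyadicBase j + dyadicScale j := by
  by_cases h : r ≤ 1
  · exact ⟨0, by simpa [dyadicBase] using hr, by simpa [dyadicBase, dyadicScale] using h⟩
  · obtain ⟨N, h1, h2⟩ := exists_nat_pow_near (not_le.1 h).le one_lt_two
    refine ⟨N + 1, ?_, ?_⟩
    · simpa [dyadicBase, dyadicScale] using h1
    · have : dyadicBase (N + 1) + dyadicScale (N + 1) = 2 ^ (N + 1) := by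
        simp [dyadicBase, dyadicScale]; ring
      rw [this]; exact h2.le

/-- The floor of y works except at the right endpoint y = N, where the last piece N - 1 is taken. -/
theorem exists_fin_le_le {N : ℕ} (hN : 0 < N) {y : ℝ} (h0 : 0 ≤ y) (h1 : y ≤ N) :
    ∃ q : Fin N, (q : ℝ) ≤ y ∧ y ≤ q + 1 := by
  by_cases h : ⌊y⌋₊ < N
  · exact ⟨⟨⌊y⌋₊, h⟩, Nat.floor_le h0, (Nat.lt_floor_add_one y).le⟩
  · have h2 : (N : ℝ) ≤ y := (Nat.le_floor_iff h0).1 (not_lt.1 h)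
    have h3 : ((N - 1 : ℕ) : ℝ) = N - 1 := by rw [Nat.cast_sub (by omega), Nat.cast_one]
    refine ⟨⟨N - 1, by omega⟩, ?_, ?_⟩ <;> simp only [h3] <;> linarith

/-- The number of pieces into which an interval of length `scale j ^ s` is divided. -/
noncomputable def pieceCount (s : ℝ) (j : ℕ) : ℕ := ⌈dyadicScale j ^ s⌉₊

theorem pieceCount_pos (s : ℝ) (j : ℕ) : 0 < pieceCount s j :=
  Nat.ceil_pos.2 (Real.rpow_pos_of_pos (dyadicScale_pos j) s)

theorem le_pieceCount (s : ℝ) (j : ℕ) : dyadicScale j ^ s ≤ pieceCount s j := Nat.le_ceil _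

theorem pieceCount_le {s : ℝ} (hs : 0 ≤ s) (j : ℕ) :
    (pieceCount s j : ℝ) ≤ 2 * dyadicScale j ^ s := by
  have h1 : 1 ≤ dyadicScale j ^ s := Real.one_le_rpow (one_le_dyadicScale j) hs
  have := Nat.ceil_lt_add_one (a := dyadicScale j ^ s) (by linarith)
  unfold pieceCount
  linarith

variable {n : ℕ} {ρ : ℝ}

/-- The cell of the face `(i, s)`, the `j`-th dyadic block, the `q`-th radial interval and the
angular cube `κ`. -/
noncomputable def dyadicCell (hρ1 : ρ ≤ 1) (i : Fin n) (s : Bool) (j : ℕ)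
    (q : Fin (pieceCount (1 - ρ) j)) (κ : {k // k ≠ i} → Fin (pieceCount (3 / 2 - ρ) j)) :
    FrequencyCell n ρ where
  i := i
  v₀ := WithLp.toLp 2 fun k => if h : k = i then (if s then 1 else -1)
    else -1 + 2 / pieceCount (3 / 2 - ρ) j * κ ⟨k, h⟩
  -- The ratios of coordinates fill [-1, 1], of length 2. The exponent 3/2 - ρ = 1/2 + (1 - ρ) meets
  -- both demands: at least 1/2 for λδ² ≤ 4, at least 1 - ρ for λδ ≤ 2λ^ρ.
  δ := 2 / pieceCount (3 / 2 - ρ) j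
  r₀ := dyadicBase j + q * (dyadicScale j / pieceCount (1 - ρ) j)
  L := dyadicScale j / pieceCount (1 - ρ) j
  lam := dyadicScale j
  abs_v₀_self := by cases s <;> simp
  abs_v₀_le := by
    intro k
    by_cases h : k = i
    · cases s <;> simp [h]
    · have hM : (0 : ℝ) < pieceCount (3 / 2 - ρ) j := by exact_mod_cast pieceCount_pos _ j
      have hκ : ((κ ⟨k, h⟩ : ℕ) : ℝ) ≤ pieceCount (3 / 2 - ρ) j := by
        exact_mod_cast (κ ⟨k, h⟩).2.le
      simp only [h, dite_false]
      have h1 : 0 ≤ 2 / (pieceCount (3 / 2 - ρ) j : ℝ) * κ ⟨k, h⟩ := by positivity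
      have h2 : 2 / (pieceCount (3 / 2 - ρ) j : ℝ) * κ ⟨k, h⟩ ≤ 2 := by
        rw [div_mul_eq_mul_div, div_le_iff₀ hM]; linarith
      rw [abs_le]; constructor <;> linarith
  δ_pos := by
    have := pieceCount_pos (3 / 2 - ρ) j
    positivity
  δ_le := by
    have : (1 : ℝ) ≤ pieceCount (3 / 2 - ρ) j := by exact_mod_cast pieceCount_pos _ j
    exact div_le_self (by norm_num) this
  r₀_nonneg := by
    have := dyadicBase_nonneg j
    have := (dyadicScale_pos j).le
    positivity
  L_pos := by
    have := pieceCount_pos (1 - ρ) j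
    have := dyadicScale_pos j
    positivity
  one_le_lam := one_le_dyadicScale j
  add_le := by
    have hK : (0 : ℝ) < pieceCount (1 - ρ) j := by exact_mod_cast pieceCount_pos _ j
    have hq : (q : ℝ) + 1 ≤ pieceCount (1 - ρ) j := by exact_mod_cast q.2
    have h1 : ((q : ℝ) + 1) * (dyadicScale j / pieceCount (1 - ρ) j) ≤ dyadicScale j := by
      rw [mul_div_assoc', div_le_iff₀ hK, mul_comm]
      exact mul_le_mul_of_nonneg_left hq (dyadicScale_pos j).le
    linarith [dyadicBase_le j]
  L_le := by
    have hK : (0 : ℝ) < pieceCount (1 - ρ) j := by exact_mod_cast pieceCount_pos _ j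
    rw [div_le_iff₀ hK]
    calc dyadicScale j = dyadicScale j ^ ρ * dyadicScale j ^ (1 - ρ) := by
          rw [← Real.rpow_add (dyadicScale_pos j)]; simp
      _ ≤ _ := by
        have := dyadicScale_pos j
        gcongr
        exact le_pieceCount _ j
  lam_mul_sq_le := by
    have hl := dyadicScale_pos j
    have hM : (0 : ℝ) < pieceCount (3 / 2 - ρ) j := by exact_mod_cast pieceCount_pos _ j
    rw [div_pow, mul_div_assoc', div_le_iff₀ (by positivity)]
    have h1 : dyadicScale j ≤ (pieceCount (3 / 2 - ρ) j : ℝ) ^ 2 := by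
      calc dyadicScale j = dyadicScale j ^ (1 : ℝ) := (Real.rpow_one _).symm
        _ ≤ dyadicScale j ^ ((3 / 2 - ρ) * (2 : ℕ)) :=
          Real.rpow_le_rpow_of_exponent_le (one_le_dyadicScale j) (by push_cast; linarith)
        _ = (dyadicScale j ^ (3 / 2 - ρ)) ^ 2 := by rw [Real.rpow_mul hl.le, Real.rpow_natCast]
        _ ≤ _ := by gcongr; exact le_pieceCount _ j
    linarith
  lam_mul_le := by
    have hl := dyadicScale_pos j
    have hM : (0 : ℝ) < pieceCount (3 / 2 - ρ) j := by exact_mod_cast pieceCount_pos _ j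
    rw [mul_div_assoc', div_le_iff₀ hM, mul_comm, mul_assoc]
    gcongr
    calc dyadicScale j = dyadicScale j ^ ρ * dyadicScale j ^ (1 - ρ) := by
          rw [← Real.rpow_add hl]; simp
      _ ≤ dyadicScale j ^ ρ * dyadicScale j ^ (3 / 2 - ρ) := by
        gcongr
        exacts [one_le_dyadicScale j, by norm_num]
      _ ≤ _ := by gcongr; exact le_pieceCount _ j
  lam_le_max := (dyadicScale_le_max j).trans (max_le_max le_rfl (le_add_of_nonneg_right (by
    have := (dyadicScale_pos j).le
    positivity)))

/-- Taking i to be a coordinate of largest modulus and s its sign puts ξ/|ξ_i| on a face of the unit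
cube. Then |ξ_i| selects the dyadic block and radial interval, and the other ratios select the
angular cube. -/
theorem exists_mem_carrier_dyadicCell (hρ1 : ρ ≤ 1) {ξ : EuclideanSpace ℝ (Fin n)} (hξ : ξ ≠ 0) :
    ∃ i s j q κ, ξ ∈ (dyadicCell hρ1 i s j q κ).carrier := by
  have hne : Nonempty (Fin n) := by
    by_contra h
    rw [not_nonempty_iff] at h
    exact hξ (Subsingleton.elim _ _)
  obtain ⟨i, hi⟩ := Finite.exists_max fun k => |ξ k|
  have hpos : 0 < |ξ i| := by
    by_contra h
    refine hξ (PiLp.ext fun k => ?_)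
    exact abs_nonpos_iff.1 ((hi k).trans (not_lt.1 h))
  let s : Bool := decide (0 < ξ i)
  have hs : (if s then (1 : ℝ) else -1) * ξ i = |ξ i| := by
    by_cases h : 0 < ξ i
    · simp [s, h, abs_of_pos h]
    · simp [s, h, abs_of_nonpos (not_lt.1 h)]
  obtain ⟨j, hj1, hj2⟩ := exists_dyadic_interval hpos.le
  have hl := dyadicScale_pos j
  have hK : (0 : ℝ) < pieceCount (1 - ρ) j := by exact_mod_cast pieceCount_pos _ j
  have hM : (0 : ℝ) < pieceCount (3 / 2 - ρ) j := by exact_mod_cast pieceCount_pos _ j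
  obtain ⟨q, hq1, hq2⟩ := exists_fin_le_le (pieceCount_pos (1 - ρ) j)
    (y := (|ξ i| - dyadicBase j) / (dyadicScale j / pieceCount (1 - ρ) j))
    (div_nonneg (by linarith) (by positivity)) (by
      rw [div_le_iff₀ (by positivity), mul_div_cancel₀ _ hK.ne']; linarith)
  have hω : ∀ k, -1 ≤ ξ k / |ξ i| ∧ ξ k / |ξ i| ≤ 1 := fun k => by
    rw [← abs_le, abs_div, abs_abs, div_le_one hpos]
    exact hi k
  have hκ : ∀ k : {k // k ≠ i}, ∃ p : Fin (pieceCount (3 / 2 - ρ) j),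
      (p : ℝ) ≤ (ξ k / |ξ i| + 1) / (2 / pieceCount (3 / 2 - ρ) j) ∧
      (ξ k / |ξ i| + 1) / (2 / pieceCount (3 / 2 - ρ) j) ≤ p + 1 := fun k =>
    exists_fin_le_le (pieceCount_pos _ j) (div_nonneg (by linarith [(hω k).1]) (by positivity)) (by
      rw [div_le_iff₀ (by positivity), mul_div_cancel₀ _ hM.ne']; linarith [(hω k).2])
  choose κ hκ1 hκ2 using hκ
  refine ⟨i, s, j, q, κ, ?_, fun k => ?_⟩
  · simpa [dyadicCell, hs] using hpos
  · by_cases hk : k = i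
    · have e : (dyadicCell hρ1 i s j q κ).coord ξ k =
          (|ξ i| - dyadicBase j) / (dyadicScale j / pieceCount (1 - ρ) j) - q := by
        rw [FrequencyCell.coord, if_pos (by exact hk)]
        simp only [dyadicCell, dite_true, hs]
        field_simp
        ring
      rw [e]
      constructor <;> linarith
    · have e : (dyadicCell hρ1 i s j q κ).coord ξ k =
          (ξ k / |ξ i| + 1) / (2 / pieceCount (3 / 2 - ρ) j) - κ ⟨k, hk⟩ := by
        rw [FrequencyCell.coord, if_neg (by exact hk)]
        simp only [dyadicCell, dite_true, hs, hk, dite_false]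
        have hd : (2 : ℝ) / pieceCount (3 / 2 - ρ) j ≠ 0 := by positivity
        rw [div_sub' hd]
        ring
      rw [e]
      have h1 := hκ1 ⟨k, hk⟩
      have h2 := hκ2 ⟨k, hk⟩
      constructor <;> linarith

theorem tsum_dyadicScale_ne_top {e : ℝ} (he : e < 0) (C : ℝ) :
    ∑' j, ENNReal.ofReal (C * dyadicScale j ^ e) ≠ (⊤ : ℝ≥0∞) := by
  refine Summable.tsum_ofReal_ne_top (Summable.mul_left _ ?_)
  -- Dropping the term j = 0 removes the truncated subtraction and leaves a geometric series.
  rw [← summable_nat_add_iff 1]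
  have h : (fun j => dyadicScale (j + 1) ^ e) = fun j : ℕ => ((2 : ℝ) ^ e) ^ j := by
    ext j
    rw [dyadicScale, Nat.add_sub_cancel, ← Real.rpow_natCast, ← Real.rpow_natCast,
      ← Real.rpow_mul (by norm_num), ← Real.rpow_mul (by norm_num), mul_comm]
  rw [h]
  exact summable_geometric_of_lt_one (by positivity)
    (Real.rpow_lt_one_of_one_lt_of_neg (by norm_num) he)

/-- Frequency space without the origin is covered by countably many cells, and there are few
enough of them for the weights `lam ^ (2 m)` to be summable. -/
theorem exists_frequencyCells (hn : 1 ≤ n) (hρ1 : ρ ≤ 1) {m : ℝ}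
    (hm : m < (n : ℝ) * (ρ - 1) / 2 - ((n : ℝ) - 1) / 4) :
    ∃ (ι : Type) (_ : Countable ι) (c : ι → FrequencyCell n ρ),
      {0}ᶜ ⊆ ⋃ a, (c a).carrier ∧
      ∑' a, ENNReal.ofReal ((c a).lam ^ m) ^ 2 ≠ (⊤ : ℝ≥0∞) := by
  let ι : Type := Σ (p : (Fin n × Bool)) (j : ℕ),
    Fin (pieceCount (1 - ρ) j) × ({k // k ≠ p.1} → Fin (pieceCount (3 / 2 - ρ) j))
  refine ⟨ι, inferInstance, fun a => dyadicCell hρ1 a.1.1 a.1.2 a.2.1 a.2.2.1 a.2.2.2, ?_, ?_⟩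
  · intro ξ hξ
    obtain ⟨i, s, j, q, κ, h⟩ := exists_mem_carrier_dyadicCell hρ1 hξ
    exact Set.mem_iUnion.2 ⟨⟨(i, s), j, q, κ⟩, h⟩
  · rw [ENNReal.tsum_sigma', tsum_fintype]
    refine (ENNReal.sum_lt_top.2 fun p _ => ?_).ne
    rw [ENNReal.tsum_sigma']
    -- The last two summands count radial intervals and angular cubes. In total e = 2m + n(1 - ρ) +
    -- (n - 1)/2, which is negative exactly under the hypothesis on m.
    set e : ℝ := 2 * m + (1 - ρ) + (n - 1) * (3 / 2 - ρ) with he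
    have he0 : e < 0 := by rw [he]; nlinarith
    refine lt_of_le_of_lt (ENNReal.tsum_le_tsum fun j => ?_)
      (tsum_dyadicScale_ne_top he0 (2 * 2 ^ (n - 1))).lt_top
    have hl := dyadicScale_pos j
    rw [tsum_fintype]
    simp only [dyadicCell, Finset.sum_const, Finset.card_univ, Fintype.card_prod, Fintype.card_fin,
      Fintype.card_pi, Finset.prod_const, nsmul_eq_mul]
    have hcard : Fintype.card {k // k ≠ p.1} = n - 1 := by simp
    rw [hcard, ← ENNReal.ofReal_pow (by positivity), ← ENNReal.ofReal_natCast,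
      ← ENNReal.ofReal_mul (by positivity)]
    refine ENNReal.ofReal_le_ofReal ?_
    have hn1 : ((n - 1 : ℕ) : ℝ) = n - 1 := by rw [Nat.cast_sub hn, Nat.cast_one]
    calc (((pieceCount (1 - ρ) j * pieceCount (3 / 2 - ρ) j ^ (n - 1) : ℕ)) : ℝ) *
          (dyadicScale j ^ m) ^ 2
        ≤ (2 * dyadicScale j ^ (1 - ρ)) * (2 * dyadicScale j ^ (3 / 2 - ρ)) ^ (n - 1) *
          (dyadicScale j ^ m) ^ 2 := by
          push_cast
          gcongr
          · exact pieceCount_le (by linarith) j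
          · exact pieceCount_le (by linarith) j
      _ = 2 * 2 ^ (n - 1) * dyadicScale j ^ e := by
          rw [mul_pow, ← Real.rpow_natCast (dyadicScale j ^ (3 / 2 - ρ)),
            ← Real.rpow_natCast (dyadicScale j ^ m), ← Real.rpow_mul hl.le, ← Real.rpow_mul hl.le,
            hn1, he, Real.rpow_add hl, Real.rpow_add hl]
          push_cast
          rw [mul_comm m 2, mul_comm ((n : ℝ) - 1)]
          ring

end Decomposition

/-! ### Measurability in x of the operator -/

section Measurability

/-- A Carathéodory argument: measurable representatives for a countable dense set of y differ from u
only on a common null set. Setting u to 0 there makes it measurable in x for all y by continuity,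
hence jointly measurable. -/
theorem exists_measurable_uncurry_of_continuous {X Y : Type*} [MeasurableSpace X] {μ : Measure X}
    [TopologicalSpace Y] [TopologicalSpace.MetrizableSpace Y] [MeasurableSpace Y]
    [SecondCountableTopology Y] [OpensMeasurableSpace Y] {u : Y → X → ℂ}
    (hc : ∀ x, Continuous fun y => u y x) (hm : ∀ y, AEMeasurable (u y) μ) :
    ∃ v : Y → X → ℂ, Measurable (Function.uncurry v) ∧ ∀ᵐ x ∂μ, ∀ y, u y x = v y x := by
  classical
  obtain ⟨S, hSc, hSd⟩ := TopologicalSpace.exists_countable_dense Y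
  have hae : ∀ᵐ x ∂μ, ∀ y ∈ S, u y x = (hm y).mk (u y) x :=
    (ae_ball_iff hSc).2 fun y _ => (hm y).ae_eq_mk
  obtain ⟨N, hN, hNm, hN0⟩ := exists_measurable_superset_of_null (ae_iff.1 hae)
  refine ⟨fun y x => if x ∈ N then 0 else u y x, ?_, ?_⟩
  · have hcont : ∀ x, Continuous fun y => if x ∈ N then 0 else u y x := by
      intro x; split_ifs
      · exact continuous_const
      · exact hc x
    refine measurable_uncurry_of_continuous_of_measurable hcont fun y => ?_
    obtain ⟨s, hs, hlim⟩ := mem_closure_iff_seq_limit.1 (hSd y)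
    refine measurable_of_tendsto_metrizable (f := fun k x => if x ∈ N then 0 else u (s k) x)
      (fun k => ?_) (tendsto_pi_nhds.2 fun x => ((hcont x).tendsto y).comp hlim)
    have : (fun x => if x ∈ N then 0 else u (s k) x) =
        fun x => if x ∈ N then 0 else (hm (s k)).mk (u (s k)) x := by
      ext x
      split_ifs with h
      · rfl
      · by_contra h'
        exact h (hN fun hall => h' (hall _ (hs k)))
    rw [this]
    exact Measurable.ite hNm measurable_const (hm (s k)).measurable_mk
  · have : ∀ᵐ x ∂μ, x ∉ N := measure_eq_zero_iff_ae_notMem.1 hN0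
    filter_upwards [this] with x hx y
    rw [if_neg hx]

theorem aestronglyMeasurable_integral_of_continuousOn {n : ℕ}
    {h : EuclideanSpace ℝ (Fin n) → EuclideanSpace ℝ (Fin n) → ℂ}
    {U : Set (EuclideanSpace ℝ (Fin n))} (hU : MeasurableSet U) (hc : ∀ x, ContinuousOn (h x) U)
    (hm : ∀ ξ ∈ U, AEMeasurable (fun x => h x ξ) volume) {w : EuclideanSpace ℝ (Fin n) → ℂ}
    (hw : Measurable w) :
    AEStronglyMeasurable (fun x => ∫ ξ in U, h x ξ * w ξ) volume := by
  obtain ⟨v, hv, huv⟩ := exists_measurable_uncurry_of_continuous (μ := volume)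
    (u := fun (ξ : U) x => h x ξ) (fun x => continuousOn_iff_continuous_domRestrict.1 (hc x))
    (fun ξ => hm ξ ξ.2)
  have h1 : Measurable fun p : EuclideanSpace ℝ (Fin n) × U => v p.2 p.1 * w p.2 :=
    (hv.comp measurable_swap).mul (hw.comp (measurable_subtype_coe.comp measurable_snd))
  have : SigmaFinite (Measure.comap (Subtype.val : U → _)
      (volume : Measure (EuclideanSpace ℝ (Fin n)))) := by
    refine SigmaFinite.of_map _ measurable_subtype_coe.aemeasurable ?_
    rw [map_comap_subtype_coe hU]
    infer_instance
  have h2 := (h1.stronglyMeasurable.integral_prod_right' (ν := Measure.comap Subtype.val volume))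
  refine h2.aestronglyMeasurable.congr ?_
  filter_upwards [huv] with x hx
  rw [← integral_subtype_comap hU]
  simp only [hx]

end Measurability

/-! ### Summation over cells and the L² bound -/

section Main

variable {n : ℕ}

theorem eLpNorm_two_eq {f : EuclideanSpace ℝ (Fin n) → ℂ} :
    eLpNorm f 2 volume = (∫⁻ x, ‖f x‖ₑ ^ 2) ^ (1 / 2 : ℝ) := by
  rw [eLpNorm_eq_lintegral_rpow_enorm_toReal (by norm_num) (by norm_num)]
  simp

theorem fourierHat_eq_oscIntegral (u : EuclideanSpace ℝ (Fin n) → ℂ)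
    (ξ : EuclideanSpace ℝ (Fin n)) : fourierHat u ξ = oscIntegral u (-ξ) := by
  unfold fourierHat oscIntegral
  congr 1 with y
  rw [inner_neg_left, real_inner_comm]
  simp

theorem lintegral_enorm_fourierHat_sq {u : EuclideanSpace ℝ (Fin n) → ℂ} (h1 : Integrable u)
    (h2 : MemLp u 2) :
    ∫⁻ ξ, ‖fourierHat u ξ‖ₑ ^ 2 = ENNReal.ofReal ((2 * Real.pi) ^ n) * ∫⁻ y, ‖u y‖ₑ ^ 2 := by
  simp_rw [fourierHat_eq_oscIntegral]
  rw [lintegral_neg_eq_self (fun ξ => ‖oscIntegral u ξ‖ₑ ^ 2), lintegral_enorm_oscIntegral_sq h1 h2]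

open FourierTransform in
theorem integrable_fourierHat (u : SchwartzMap (EuclideanSpace ℝ (Fin n)) ℂ) :
    Integrable (fourierHat u) := by
  have h : fourierHat u = fun ξ => (𝓕 u) (((2 * Real.pi)⁻¹ : ℝ) • ξ) := by
    ext ξ
    rw [fourierHat_eq_oscIntegral, oscIntegral_eq_fourier, smul_neg, neg_smul, neg_neg,
      SchwartzMap.fourier_coe]
  rw [h]
  exact (𝓕 u).integrable.comp_smul (by have := Real.pi_pos; positivity)

theorem continuous_fourierHat {u : EuclideanSpace ℝ (Fin n) → ℂ} (h1 : Integrable u) :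
    Continuous (fourierHat u) := by
  have : fourierHat u = fun ξ => oscIntegral u (-ξ) := funext (fourierHat_eq_oscIntegral u)
  rw [this]
  exact (continuous_oscIntegral h1).comp continuous_neg

theorem memLp_fourierHat (u : SchwartzMap (EuclideanSpace ℝ (Fin n)) ℂ) :
    MemLp (fourierHat u) 2 := by
  refine ⟨(continuous_fourierHat u.integrable).aestronglyMeasurable, ?_⟩
  have hu2 : MemLp (u : EuclideanSpace ℝ (Fin n) → ℂ) 2 volume := u.memLp 2 volume
  have hu := hu2.2
  rw [eLpNorm_two_eq] at hu ⊢
  rw [lintegral_enorm_fourierHat_sq u.integrable hu2,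
    ENNReal.mul_rpow_of_nonneg _ _ (by norm_num)]
  exact ENNReal.mul_lt_top (ENNReal.rpow_lt_top_of_nonneg (by norm_num) ENNReal.ofReal_ne_top) hu

variable {m ρ : ℝ} {a : EuclideanSpace ℝ (Fin n) → EuclideanSpace ℝ (Fin n) → ℂ}
  {φ : EuclideanSpace ℝ (Fin n) → EuclideanSpace ℝ (Fin n) → ℝ}

/-- Only finitely many derivative orders matter, so summing their constants gives one pair that
works off a single null set. -/
theorem exists_uniform_bounds (ha : IsRoughAmplitude m ρ a) (hφ : IsRoughPhase 2 φ) :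
    ∃ Cf Cb : ℝ, ∀ᵐ x,
      (∀ k, 2 ≤ k → k ≤ n + 2 → ∀ ξ, 1 ≤ ‖ξ‖ → ‖iteratedFDeriv ℝ k (φ x) ξ‖ ≤ Cf) ∧
      (∀ k ≤ n, ∀ ξ, ‖iteratedFDeriv ℝ k (a x) ξ‖ ≤ Cb * japaneseBracket ξ ^ (m - ρ * k)) := by
  choose B hB0 hB using ha.ae_norm_iteratedFDeriv_le
  have h : ∀ k, ∃ C : ℝ, 0 ≤ C ∧ (2 ≤ k → ∀ᵐ x, ∀ ξ, 1 ≤ ‖ξ‖ →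
      ‖iteratedFDeriv ℝ k (φ x) ξ‖ ≤ C) := by
    intro k
    by_cases hk : 2 ≤ k
    · obtain ⟨C, hC, h⟩ := hφ.ae_norm_iteratedFDeriv_le hk (by omega)
      exact ⟨C, hC, fun _ => h⟩
    · exact ⟨0, le_rfl, fun h => absurd h hk⟩
  choose A hA0 hA using h
  refine ⟨∑ k ∈ Finset.range (n + 3), A k, ∑ k ∈ Finset.range (n + 1), B k, ?_⟩
  have hA' : ∀ᵐ x, ∀ k, 2 ≤ k → ∀ ξ, 1 ≤ ‖ξ‖ → ‖iteratedFDeriv ℝ k (φ x) ξ‖ ≤ A k := by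
    refine ae_all_iff.2 fun k => ?_
    by_cases hk : 2 ≤ k
    · filter_upwards [hA k hk] with x hx _ using hx
    · exact ae_of_all _ fun x h => absurd h hk
  filter_upwards [hA', ae_all_iff.2 hB] with x hx1 hx2
  refine ⟨fun k h2 hk ξ hξ => (hx1 k h2 ξ hξ).trans ?_, fun k hk ξ => (hx2 k ξ).trans ?_⟩
  · exact Finset.single_le_sum (fun i _ => hA0 i) (Finset.mem_range.2 (by omega))
  · refine mul_le_mul_of_nonneg_right ?_ (Real.rpow_nonneg
      (zero_le_one.trans (one_le_japaneseBracket ξ)) _)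
    exact Finset.single_le_sum (fun i _ => hB0 i) (Finset.mem_range.2 (by omega))

theorem continuousOn_symbol (ha : IsRoughAmplitude m ρ a) (hφ : IsRoughPhase 2 φ)
    (x : EuclideanSpace ℝ (Fin n)) :
    ContinuousOn (fun ξ => Complex.exp (Complex.I * (φ x ξ : ℝ)) * a x ξ) {0}ᶜ := by
  refine ContinuousOn.mul ?_ (ha.smooth x).continuous.continuousOn
  exact (continuousOn_const.mul
    (Complex.continuous_ofReal.comp_continuousOn (hφ.smooth x).continuousOn)).cexp

theorem integrable_symbol_mul (hn : 1 ≤ n) (ha : IsRoughAmplitude m ρ a) (hφ : IsRoughPhase 2 φ)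
    (hm : m ≤ 0) {w : EuclideanSpace ℝ (Fin n) → ℂ} (hw : Integrable w) :
    ∀ᵐ x, Integrable fun ξ => Complex.exp (Complex.I * (φ x ξ : ℝ)) * a x ξ * w ξ := by
  have : Nonempty (Fin n) := ⟨⟨0, hn⟩⟩
  obtain ⟨_, Cb, hC⟩ := exists_uniform_bounds ha hφ
  filter_upwards [hC] with x hx
  have hrestrict : (volume : Measure (EuclideanSpace ℝ (Fin n))).restrict {0}ᶜ = volume :=
    Measure.restrict_eq_self_of_ae_mem (by simp [ae_iff])
  refine hw.bdd_mul (c := |Cb|) ?_ (ae_of_all _ fun ξ => ?_)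
  · rw [← hrestrict]
    exact (continuousOn_symbol ha hφ x).aestronglyMeasurable (measurableSet_singleton _).compl
  · have h := hx.2 0 (by omega) ξ
    rw [norm_iteratedFDeriv_zero] at h
    rw [norm_mul, mul_comm Complex.I, Complex.norm_exp_ofReal_mul_I, one_mul]
    refine h.trans ((mul_le_mul_of_nonneg_right (le_abs_self Cb) (Real.rpow_nonneg
      (zero_le_one.trans (one_le_japaneseBracket ξ)) _)).trans ?_)
    refine mul_le_of_le_one_right (abs_nonneg _) ?_
    exact Real.rpow_le_one_of_one_le_of_nonpos (one_le_japaneseBracket ξ) (by simpa using hm)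

theorem exists_lintegral_sq_symbol_le (hn : 1 ≤ n) (hρ0 : 0 ≤ ρ) (hρ1 : ρ ≤ 1)
    (ha : IsRoughAmplitude m ρ a) (hφ : IsRoughPhase 2 φ) (hnd : IsRoughNondegenerate φ)
    (hm : m < (n : ℝ) * (ρ - 1) / 2 - ((n : ℝ) - 1) / 4) :
    ∃ A : ℝ≥0∞, A ≠ ⊤ ∧ ∀ w : EuclideanSpace ℝ (Fin n) → ℂ, Measurable w → Integrable w →
      MemLp w 2 → ∫⁻ x, ‖∫ ξ, Complex.exp (Complex.I * (φ x ξ : ℝ)) * a x ξ * w ξ‖ₑ ^ 2 ≤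
        A * ∫⁻ ξ, ‖w ξ‖ₑ ^ 2 := by
  have hne : Nonempty (Fin n) := ⟨⟨0, hn⟩⟩
  have hn1 : (1 : ℝ) ≤ n := by exact_mod_cast hn
  have hm0 : m ≤ 0 := by nlinarith
  obtain ⟨Cf, Cb, hC⟩ := exists_uniform_bounds ha hφ
  obtain ⟨ι, _, c, hcover, hsum⟩ := exists_frequencyCells hn hρ1 hm
  obtain ⟨D, hDm, hDc, hDd, hDU⟩ :=
    exists_measurable_disjoint_refinement fun i => (c i).measurableSet_carrier
  obtain ⟨c₀, hc₀, hz⟩ := hnd.lower_bound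
  obtain ⟨K, hK, hKz⟩ := exists_map_le_smul_volume (n := n) hc₀
  have hv0 : ∀ i, (c i).v₀ ≠ 0 := by
    intro i h
    have := (c i).abs_v₀_self
    rw [h] at this
    simp at this
  have hzm : ∀ i, AEMeasurable (fun x => gradient (φ x) (c i).v₀) volume := fun i =>
    aemeasurable_gradient hφ.measurable (hv0 i) fun x => ((hφ.smooth x).contDiffAt
      (isOpen_compl_singleton.mem_nhds (hv0 i))).differentiableAt (by simp)
  let p : ι → ℝ≥0∞ := fun i =>
    ENNReal.ofReal (FrequencyCell.bound n Cf Cb * (c i).lam ^ m) ^ 2 * 2 ^ n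
  have hp : ∑' i, p i ≠ ⊤ := by
    have : ∀ i, p i = ENNReal.ofReal (FrequencyCell.bound n Cf Cb) ^ 2 * 2 ^ n *
        ENNReal.ofReal ((c i).lam ^ m) ^ 2 := by
      intro i
      have : 0 ≤ (c i).lam ^ m := Real.rpow_nonneg (zero_le_one.trans (c i).one_le_lam) _
      simp only [p]
      rw [ENNReal.ofReal_mul' this, mul_pow]
      ring
    simp_rw [this]
    rw [ENNReal.tsum_mul_left]
    refine ENNReal.mul_ne_top (ENNReal.mul_ne_top ?_ ?_) hsum
    · exact ENNReal.pow_ne_top ENNReal.ofReal_ne_top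
    · exact ENNReal.pow_ne_top (by norm_num)
  refine ⟨(∑' i, p i) * (K * (2 ^ n * ENNReal.ofReal ((2 * Real.pi) ^ n))),
    ENNReal.mul_ne_top hp (ENNReal.mul_ne_top hK (ENNReal.mul_ne_top
      (ENNReal.pow_ne_top (by norm_num)) ENNReal.ofReal_ne_top)), fun w hwm hw hw2 => ?_⟩
  let Y : ι → EuclideanSpace ℝ (Fin n) → ℝ≥0∞ := fun i y =>
    truncatedSquare (c i).param ((D i).indicator w) y
  have hYm : ∀ i, Measurable (Y i) := fun i =>
    measurable_truncatedSquare (hwm.indicator (hDm i)) (c i).measurable_param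
  -- The only use of non-degeneracy: integrating Y along the gradient map costs the factor K, after
  -- which Plancherel applies to the piece of w on this cell.
  have hYint : ∀ i, ∫⁻ x, Y i (gradient (φ x) (c i).v₀) ≤
      K * (2 ^ n * ENNReal.ofReal ((2 * Real.pi) ^ n)) * ∫⁻ ξ in D i, ‖w ξ‖ₑ ^ 2 := by
    intro i
    calc ∫⁻ x, Y i (gradient (φ x) (c i).v₀)
        = ∫⁻ y, Y i y ∂(Measure.map (fun x => gradient (φ x) (c i).v₀) volume) :=
          (lintegral_map' (hYm i).aemeasurable (hzm i)).symm
      _ ≤ ∫⁻ y, Y i y ∂(K • volume) :=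
          lintegral_mono' (hKz _ (hzm i) fun x y => hz x y _ (hv0 i)) le_rfl
      _ = K * ∫⁻ y, Y i y := lintegral_smul_measure _ _
      _ ≤ K * (2 ^ n * (ENNReal.ofReal ((2 * Real.pi) ^ n) *
            ∫⁻ ξ, ‖(D i).indicator w ξ‖ₑ ^ 2)) := by
          gcongr
          exact lintegral_truncatedSquare_le (hwm.indicator (hDm i)) (hw.indicator (hDm i))
            (hw2.indicator (hDm i)) (c i).measurable_param
      _ = _ := by
          rw [← lintegral_indicator (hDm i), mul_assoc, mul_assoc]
          congr 4 with ξ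
          by_cases h : ξ ∈ D i <;> simp [h]
  -- The disjoint pieces cover everything except the null origin. Cauchy–Schwarz over cells
  -- separates the weights from the square functions.
  have hpt : ∀ᵐ x, ‖∫ ξ, Complex.exp (Complex.I * (φ x ξ : ℝ)) * a x ξ * w ξ‖ₑ ^ 2 ≤
      (∑' i, p i) * ∑' i, Y i (gradient (φ x) (c i).v₀) := by
    filter_upwards [hC, integrable_symbol_mul hn ha hφ hm0 hw] with x hx hint
    have hU : (volume : Measure (EuclideanSpace ℝ (Fin n))).restrict (⋃ i, D i) = volume := by
      refine Measure.restrict_eq_self_of_ae_mem ?_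
      have : ∀ᵐ ξ : EuclideanSpace ℝ (Fin n), ξ ∈ ({0}ᶜ : Set (EuclideanSpace ℝ (Fin n))) := by
        simp [ae_iff]
      filter_upwards [this] with ξ hξ
      rw [hDU]
      exact hcover hξ
    have hsumI := hasSum_integral_iUnion hDm hDd hint.integrableOn
    rw [hU] at hsumI
    rw [← hsumI.tsum_eq]
    calc _ ≤ (∑' i, ‖∫ ξ in D i, Complex.exp (Complex.I * (φ x ξ : ℝ)) * a x ξ * w ξ‖ₑ) ^ 2 := by
          gcongr
          exact enorm_tsum_le_tsum_enorm
      _ ≤ _ := ENNReal.sq_tsum_le fun i =>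
          (c i).enorm_sq_setIntegral_le (hDm i) (hDc i) hwm hw hm0 hρ0 (hφ.smooth x)
            (hφ.homogeneous x) (ha.smooth x) hx.1 hx.2
  calc _ ≤ ∫⁻ x, (∑' i, p i) * ∑' i, Y i (gradient (φ x) (c i).v₀) := lintegral_mono_ae hpt
    _ = (∑' i, p i) * ∑' i, ∫⁻ x, Y i (gradient (φ x) (c i).v₀) := by
        have hYz : ∀ i, AEMeasurable (fun x => Y i (gradient (φ x) (c i).v₀)) volume :=
          fun i => (hYm i).comp_aemeasurable (hzm i)
        rw [lintegral_const_mul' _ _ hp, lintegral_tsum hYz]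
    _ ≤ (∑' i, p i) * ∑' i, K * (2 ^ n * ENNReal.ofReal ((2 * Real.pi) ^ n)) *
          ∫⁻ ξ in D i, ‖w ξ‖ₑ ^ 2 := by
        gcongr with i
        exact hYint i
    _ = (∑' i, p i) * (K * (2 ^ n * ENNReal.ofReal ((2 * Real.pi) ^ n)) *
          ∫⁻ ξ in ⋃ i, D i, ‖w ξ‖ₑ ^ 2) := by
        rw [ENNReal.tsum_mul_left, lintegral_iUnion hDm hDd]
    _ ≤ (∑' i, p i) * (K * (2 ^ n * ENNReal.ofReal ((2 * Real.pi) ^ n)) *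
          ∫⁻ ξ, ‖w ξ‖ₑ ^ 2) := by
        gcongr
        exact Measure.restrict_le_self
    _ = _ := by ring

theorem aestronglyMeasurable_integral_symbol (hn : 1 ≤ n) (ha : IsRoughAmplitude m ρ a)
    (hφ : IsRoughPhase 2 φ) {w : EuclideanSpace ℝ (Fin n) → ℂ} (hw : Measurable w) :
    AEStronglyMeasurable
      (fun x => ∫ ξ, Complex.exp (Complex.I * (φ x ξ : ℝ)) * a x ξ * w ξ) volume := by
  have : Nonempty (Fin n) := ⟨⟨0, hn⟩⟩
  have hrestrict : (volume : Measure (EuclideanSpace ℝ (Fin n))).restrict {0}ᶜ = volume :=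
    Measure.restrict_eq_self_of_ae_mem (by simp [ae_iff])
  have h := aestronglyMeasurable_integral_of_continuousOn (measurableSet_singleton 0).compl
    (continuousOn_symbol ha hφ) (fun ξ hξ => ?_) hw
  · rwa [hrestrict] at h
  · have h1 : AEMeasurable (fun x => φ x ξ) volume := hφ.measurable ξ hξ
    have h2 := ha.measurable ξ
    fun_prop

end Main

theorem mainTheorem11 (n : ℕ) (hn : 1 ≤ n) (m ρ : ℝ) (hρ0 : 0 ≤ ρ) (hρ1 : ρ ≤ 1)
    (a : EuclideanSpace ℝ (Fin n) → EuclideanSpace ℝ (Fin n) → ℂ)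
    (ha : IsRoughAmplitude m ρ a)
    (φ : EuclideanSpace ℝ (Fin n) → EuclideanSpace ℝ (Fin n) → ℝ)
    (hφ : IsRoughPhase 2 φ) (hnd : IsRoughNondegenerate φ)
    (hm : m < (n : ℝ) * (ρ - 1) / 2 - ((n : ℝ) - 1) / 4) :
    ∃ C : ℝ, 0 < C ∧ ∀ u : SchwartzMap (EuclideanSpace ℝ (Fin n)) ℂ,
      (∀ᵐ x, Integrable (fioIntegrand a φ u x) volume) ∧
      MemLp (fourierIntegralOperator a φ u) 2 volume ∧
      eLpNorm (fourierIntegralOperator a φ u) 2 volume ≤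
        ENNReal.ofReal C * eLpNorm (u : EuclideanSpace ℝ (Fin n) → ℂ) 2 volume := by
  have hn1 : (1 : ℝ) ≤ n := by exact_mod_cast hn
  have hm0 : m ≤ 0 := by nlinarith
  obtain ⟨A, hA, hT⟩ := exists_lintegral_sq_symbol_le hn hρ0 hρ1 ha hφ hnd hm
  let κ : ℂ := ((2 * Real.pi : ℝ) : ℂ)⁻¹ ^ n
  let B : ℝ≥0∞ := ‖κ‖ₑ ^ 2 * (A * ENNReal.ofReal ((2 * Real.pi) ^ n))
  have hB : B ^ (1 / 2 : ℝ) ≠ ⊤ := by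
    refine ENNReal.rpow_ne_top_of_nonneg (by norm_num) (ENNReal.mul_ne_top ?_
      (ENNReal.mul_ne_top hA ENNReal.ofReal_ne_top))
    exact ENNReal.pow_ne_top enorm_ne_top
  -- B combines the normalisation, the cell estimate and the (2π)^n from Plancherel for u; adding 1
  -- makes the constant strictly positive.
  refine ⟨(B ^ (1 / 2 : ℝ)).toReal + 1, by positivity, fun u => ?_⟩
  have hu2 : MemLp (u : EuclideanSpace ℝ (Fin n) → ℂ) 2 volume := u.memLp 2 volume
  have hum := (continuous_fourierHat u.integrable).measurable
  have hmeas : AEStronglyMeasurable (fourierIntegralOperator a φ u) volume :=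
    (aestronglyMeasurable_integral_symbol hn ha hφ hum).const_mul κ
  have hbound : eLpNorm (fourierIntegralOperator a φ u) 2 volume ≤
      ENNReal.ofReal ((B ^ (1 / 2 : ℝ)).toReal + 1) * eLpNorm (u : EuclideanSpace ℝ (Fin n) → ℂ) 2 volume := by
    rw [eLpNorm_two_eq, eLpNorm_two_eq]
    calc _ ≤ (B * ∫⁻ x, ‖u x‖ₑ ^ 2) ^ (1 / 2 : ℝ) := by
          gcongr
          have h := hT _ hum (integrable_fourierHat u) (memLp_fourierHat u)
          rw [lintegral_enorm_fourierHat_sq u.integrable hu2] at h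
          have e : ∀ x, ‖fourierIntegralOperator a φ u x‖ₑ ^ 2 = ‖κ‖ₑ ^ 2 *
              ‖∫ ξ, Complex.exp (Complex.I * (φ x ξ : ℝ)) * a x ξ * fourierHat u ξ‖ₑ ^ 2 := by
            intro x
            rw [← mul_pow, ← enorm_mul]
            rfl
          simp_rw [e]
          rw [lintegral_const_mul' _ _ (ENNReal.pow_ne_top enorm_ne_top)]
          calc _ ≤ ‖κ‖ₑ ^ 2 * (A * (ENNReal.ofReal ((2 * Real.pi) ^ n) * ∫⁻ x, ‖u x‖ₑ ^ 2)) := by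
                gcongr
            _ = _ := by simp only [B]; ring
      _ = B ^ (1 / 2 : ℝ) * (∫⁻ x, ‖u x‖ₑ ^ 2) ^ (1 / 2 : ℝ) :=
          ENNReal.mul_rpow_of_nonneg _ _ (by norm_num)
      _ ≤ _ := by
          gcongr
          rw [← ENNReal.ofReal_toReal hB]
          refine ENNReal.ofReal_le_ofReal ?_
          rw [ENNReal.ofReal_toReal hB]
          linarith
  refine ⟨integrable_symbol_mul hn ha hφ hm0 (integrable_fourierHat u), ⟨hmeas, ?_⟩, hbound⟩
  exact hbound.trans_lt (ENNReal.mul_lt_top ENNReal.ofReal_lt_top hu2.2)
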